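/- Let $p>2$, $a,b>0$, $\alpha\in(0,3)$. On the lattice graph $\mathbb Z^3$ ($x\sim y$ iff $\sum_i|x_i-y_i|=1$) write $\Delta u(x)=\sum_{y\sim x}(u(y)-u(x))$, $\nabla u\nabla v(x)=\frac12\sum_{y\sim x}(u(y)-u(x))(v(y)-v(x))$, $|\nabla u|^2=\nabla u\nabla u$ and $\int f\,d\mu=\sum_{x\in\mathbb Z^3}f(x)$. With $\mu(k)=6-2\sum_{j=1}^3\cos k_j$ and $\mathbb T^3=[0,2\pi]^3$ put $$R_\alpha(x,y)=\frac{K_\alpha}{(2\pi)^3}\int_{\mathbb T^3}e^{i(x-y)\cdot k}\mu(k)^{-\alpha/2}\,dk,\qquad K_\alpha=\frac1{(2\pi)^3}\int_{\mathbb T^3}\mu(k)^{\alpha/2}\,dk,$$ and $(R_\alpha*f)(x)=\sum_y R_\alpha(x,y)f(y)$. Let $h:\mathbb Z^3\to\mathbb R$ satisfy $h\ge h_0$ on $\mathbb Z^3$ for some constant $h_0>0$, and let $h$ be $\tau$-periodic for some integer $\tau\neq0$, i.e. $h(x+\tau z)=h(x)$ for all $x,z\in\mathbb Z^3$. Let $H^1(\mathbb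 Z^3)$ be the completion of the finitely supported functions for $\left(\int(|\nabla u|^2+u^2)\,d\mu\right)^{1/2}$, let $H=\{u\in H^1(\mathbb Z^3):\int hu^2\,d\mu<\infty\}$ with the norm $\|u\|=\left(\int(a|\nabla u|^2+hu^2)\,d\mu\right)^{1/2}$, and let, for $u\in H$, $$J(u)=\frac12\int\left(a|\nabla u|^2+hu^2\right)d\mu+\frac b4\left(\int|\nabla u|^2\,d\mu\right)^2-\frac1{2p}\int(R_\alpha*|u|^p)|u|^p\,d\mu.$$ Then $J\in C^1(H,\mathbb R)$, and, with the Nehari manifold $\mathcal N=\{u\in H\setminus\{0\}:(J'(u),u)=0\}$, the equation $$-\left(a+b\int|\nabla u|^2\,d\mu\right)\Delta u+hu=(R_\alpha*|u|^p)|u|^{p-2}u\quad\text{on }\mathbb Z^3$$ has a ground state solution: there is $u\in\mathcal N$ with $J'(u)=0$ and $J(u)=c:=\inf_{\mathcal N}J$ (the infimum being finite), and this $u$ satisfies the equation at every point of $\mathbb Z^3$. -/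

import Mathlib

/-! The lattice graph `ℤ³`, its discrete calculus, the kernel `R_α`, the Hilbert space `H`,
the energy functional `J`, and the Nehari manifold. -/

noncomputable section

namespace KirchhoffChoquard

/-- The vertex set `ℤ³`. -/
abbrev V : Type := Fin 3 → ℤ

/-- The finite set of neighbours of `x` in the lattice graph; see `mem_nbrs`. -/
def nbrs (x : V) : Finset V :=
  (Finset.Icc (x - 1) (x + 1)).filter (fun y => ∑ i, |x i - y i| = 1)

theorem mem_nbrs {x y : V} : y ∈ nbrs x ↔ ∑ i, |x i - y i| = 1 := by
  simp only [nbrs, Finset.mem_filter, Finset.mem_Icc, and_iff_right_iff_imp]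
  intro h
  have key : ∀ i, |x i - y i| ≤ 1 := fun i => by
    rw [← h]
    exact Finset.single_le_sum (f := fun i => |x i - y i|) (fun j _ => abs_nonneg _)
      (Finset.mem_univ i)
  constructor
  · intro i
    have := abs_le.1 (key i)
    simp only [Pi.sub_apply, Pi.one_apply]
    linarith [this.2]
  · intro i
    have := abs_le.1 (key i)
    simp only [Pi.add_apply, Pi.one_apply]
    linarith [this.1]

/-- The Laplacian `Δu(x) = ∑_{y ∼ x} (u(y) - u(x))`. -/
def lap (u : V → ℝ) (x : V) : ℝ := ∑ y ∈ nbrs x, (u y - u x)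

/-- The gradient form `Γ(u,v)(x) = ½ ∑_{y ∼ x} (u(y) - u(x)) (v(y) - v(x))`, also written
`∇u ∇v`; in particular `Γ(u,u) = |∇u|²`. -/
def gradForm (u v : V → ℝ) (x : V) : ℝ :=
  (1 / 2) * ∑ y ∈ nbrs x, (u y - u x) * (v y - v x)

/-- `μ(k) = 6 - 2 ∑ⱼ cos kⱼ`. -/
def symb (k : Fin 3 → ℝ) : ℝ := 6 - 2 * ∑ j, Real.cos (k j)

/-- `𝕋³ = [0, 2π]³`. -/
def torus : Set (Fin 3 → ℝ) := Set.Icc 0 (fun _ => 2 * Real.pi)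

/-- The fractional degree `K_α = (2π)⁻³ ∫_{𝕋³} μ(k)^{α/2} dk`. -/
def fracDeg (α : ℝ) : ℝ := 1 / (2 * Real.pi) ^ 3 * ∫ k in torus, symb k ^ (α / 2)

/-- The kernel `R_α(x,y) = K_α (2π)⁻³ ∫_{𝕋³} e^{i (x-y)·k} μ(k)^{-α/2} dk`. The integral is
a real number (substitute `k ↦ 2π - k`), so taking the real part only changes its type. -/
def riesz (α : ℝ) (x y : V) : ℝ :=
  fracDeg α / (2 * Real.pi) ^ 3 *
    (∫ k in torus, Complex.exp (Complex.I * ((∑ j, ((x j - y j : ℤ) : ℝ) * k j : ℝ) : ℂ)) *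
      ((symb k ^ (-(α / 2)) : ℝ) : ℂ)).re

/-- The convolution `(R_α ∗ f)(x) = ∑_y R_α(x,y) f(y)`. -/
def conv (α : ℝ) (f : V → ℝ) (x : V) : ℝ := ∑' y, riesz α x y * f y

/-- `u` belongs to `H¹(ℤ³)`, the completion of `C_c(ℤ³)` for the norm
`‖u‖² = ∑ (|∇u|² + u²)`, realised as a space of functions: `u` has finite norm and is the limit
in this norm of finitely supported functions. -/
def MemH1 (u : V → ℝ) : Prop :=
  Summable (fun x => gradForm u u x + u x ^ 2) ∧
  ∀ ε > 0, ∃ φ : V → ℝ, φ.support.Finite ∧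
    ∑' x, (gradForm (u - φ) (u - φ) x + (u - φ) x ^ 2) < ε

theorem gradForm_self_nonneg (u : V → ℝ) (x : V) : 0 ≤ gradForm u u x := by
  unfold gradForm
  exact mul_nonneg (by norm_num) (Finset.sum_nonneg fun y _ => mul_self_nonneg _)

theorem sum_nbrs (f : V → ℝ) (x : V) : ∑ y ∈ nbrs x, f y = ∑ e ∈ nbrs 0, f (x + e) := by
  refine (Finset.sum_bij (fun e _ => x + e) ?_ ?_ ?_ ?_).symm
  · intro e he
    rw [mem_nbrs] at he ⊢
    simpa using he
  · intro a _ b _ hab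
    exact add_left_cancel hab
  · intro y hy
    refine ⟨y - x, ?_, by simp⟩
    rw [mem_nbrs] at hy ⊢
    simpa [abs_sub_comm] using hy
  · intro e _
    rfl

theorem gradForm_self_le (u : V → ℝ) (x : V) :
    gradForm u u x ≤ ∑ e ∈ nbrs 0, (u (x + e) ^ 2 + u x ^ 2) := by
  unfold gradForm
  rw [sum_nbrs (fun y => (u y - u x) * (u y - u x)), Finset.mul_sum]
  refine Finset.sum_le_sum fun e _ => ?_
  nlinarith [sq_nonneg (u (x + e) + u x)]

theorem hasSum_bound {u : V → ℝ} (hu : Summable fun x => u x ^ 2) :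
    HasSum (fun x => ∑ e ∈ nbrs 0, (u (x + e) ^ 2 + u x ^ 2))
      (∑ _e ∈ nbrs 0, ((∑' x, u x ^ 2) + ∑' x, u x ^ 2)) := by
  refine hasSum_sum fun e _ => HasSum.add ?_ hu.hasSum
  exact (Equiv.addRight e).hasSum_iff (f := fun x => u x ^ 2) |>.2 hu.hasSum

theorem summable_gradForm_self {u : V → ℝ} (hu : Summable fun x => u x ^ 2) :
    Summable (gradForm u u) :=
  Summable.of_nonneg_of_le (gradForm_self_nonneg u) (gradForm_self_le u) (hasSum_bound hu).summable

theorem tsum_gradForm_self_le {u : V → ℝ} (hu : Summable fun x => u x ^ 2) :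
    ∑' x, gradForm u u x ≤ ((nbrs 0).card * 2) * ∑' x, u x ^ 2 := by
  have h := (summable_gradForm_self hu).tsum_le_tsum (gradForm_self_le u) (hasSum_bound hu).summable
  rw [(hasSum_bound hu).tsum_eq, Finset.sum_const, nsmul_eq_mul] at h
  linarith

/-- As a set of functions, `H¹(ℤ³)` is `ℓ²(ℤ³)`. -/
theorem memH1_iff {u : V → ℝ} : MemH1 u ↔ Summable (fun x => u x ^ 2) := by
  constructor
  · intro h
    exact Summable.of_nonneg_of_le (fun x => sq_nonneg _)
      (fun x => le_add_of_nonneg_left (gradForm_self_nonneg u x)) h.1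
  · intro hu
    refine ⟨(summable_gradForm_self hu).add hu, fun ε hε => ?_⟩
    set C : ℝ := (nbrs 0).card * 2 + 1 with hC
    have hCpos : 0 < C := by positivity
    obtain ⟨s, hs⟩ := ((tendsto_order.1
      (tendsto_tsum_compl_atTop_zero fun x => u x ^ 2)).2 (ε / C) (by positivity)).exists
    classical
    refine ⟨fun x => if x ∈ s then u x else 0, s.finite_toSet.subset ?_, ?_⟩
    · intro x hx
      by_contra hxs
      exact hx (if_neg hxs)
    · set w : V → ℝ := u - fun x => if x ∈ s then u x else 0 with hw
      have hw2 : (fun x => w x ^ 2) = (fun x => ({x | x ∉ s} : Set V).indicator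
          (fun x => u x ^ 2) x) := by
        funext x
        by_cases hx : x ∈ s <;> simp [hw, hx]
      have hws : Summable fun x => w x ^ 2 := by
        rw [hw2]; exact hu.indicator _
      have hwt : ∑' x, w x ^ 2 < ε / C := by
        rw [hw2, ← tsum_subtype]; exact hs
      rw [(summable_gradForm_self hws).tsum_add hws]
      have h1 := tsum_gradForm_self_le hws
      have h2 : C * ∑' x, w x ^ 2 < ε := by
        rw [lt_div_iff₀ hCpos] at hwt; linarith
      rw [hC] at h2
      linarith

theorem gradForm_add_left (u v w : V → ℝ) (x : V) :
    gradForm (u + v) w x = gradForm u w x + gradForm v w x := by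
  simp only [gradForm, Pi.add_apply, ← mul_add, ← Finset.sum_add_distrib]
  congr 1
  exact Finset.sum_congr rfl fun y _ => by ring

theorem gradForm_smul_left (c : ℝ) (u w : V → ℝ) (x : V) :
    gradForm (c • u) w x = c * gradForm u w x := by
  simp only [gradForm, Pi.smul_apply, smul_eq_mul, Finset.mul_sum]
  exact Finset.sum_congr rfl fun y _ => by ring

theorem gradForm_comm (u v : V → ℝ) (x : V) : gradForm u v x = gradForm v u x := by
  simp only [gradForm, mul_comm]

theorem abs_gradForm_le (u v : V → ℝ) (x : V) :
    |gradForm u v x| ≤ gradForm u u x + gradForm v v x := by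
  simp only [gradForm, ← mul_add, ← Finset.sum_add_distrib, abs_mul]
  rw [abs_of_pos (by norm_num : (0 : ℝ) < 1 / 2)]
  refine mul_le_mul_of_nonneg_left ((Finset.abs_sum_le_sum_abs _ _).trans
    (Finset.sum_le_sum fun y _ => ?_)) (by norm_num)
  rw [abs_le]
  constructor <;> nlinarith [sq_nonneg ((u y - u x) + (v y - v x)),
    sq_nonneg ((u y - u x) - (v y - v x)), mul_self_nonneg (u y - u x), mul_self_nonneg (v y - v x)]

theorem summable_gradForm {u v : V → ℝ} (hu : Summable fun x => u x ^ 2)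
    (hv : Summable fun x => v x ^ 2) : Summable (gradForm u v) :=
  Summable.of_norm_bounded ((summable_gradForm_self hu).add (summable_gradForm_self hv))
    (abs_gradForm_le u v)

theorem summable_weighted_mul {h u v : V → ℝ} (hh : ∀ x, 0 ≤ h x)
    (hu : Summable fun x => h x * u x ^ 2) (hv : Summable fun x => h x * v x ^ 2) :
    Summable fun x => h x * (u x * v x) := by
  refine Summable.of_norm_bounded (hu.add hv) fun x => ?_
  rw [Real.norm_eq_abs, abs_mul, abs_of_nonneg (hh x), ← mul_add]
  refine mul_le_mul_of_nonneg_left ?_ (hh x)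
  rw [abs_le]
  constructor <;> nlinarith [sq_nonneg (u x + v x), sq_nonneg (u x - v x), sq_nonneg (u x),
    sq_nonneg (v x)]

/-- The condition `h ≥ h₀ > 0` on the potential. -/
def PosBelow (h : V → ℝ) : Prop := ∃ h₀ > 0, ∀ x, h₀ ≤ h x

theorem PosBelow.nonneg {h : V → ℝ} (hh : PosBelow h) (x : V) : 0 ≤ h x := by
  obtain ⟨h₀, h1, h2⟩ := hh
  exact h1.le.trans (h2 x)

theorem PosBelow.pos {h : V → ℝ} (hh : PosBelow h) (x : V) : 0 < h x := by
  obtain ⟨h₀, h1, h2⟩ := hh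
  exact h1.trans_le (h2 x)

/-- `h` is `τ`-periodic: invariant under all translations by vectors of `τℤ³`. -/
def IsPeriodic (τ : ℤ) (h : V → ℝ) : Prop := ∀ x z : V, h (x + τ • z) = h x

/-- The vector space `H = {u ∈ H¹(ℤ³) : ∑ h u² < ∞}`. -/
def HSub (h : V → ℝ) (hh : PosBelow h) : Submodule ℝ (V → ℝ) where
  carrier := {u | MemH1 u ∧ Summable fun x => h x * u x ^ 2}
  zero_mem' := by
    refine ⟨memH1_iff.2 ?_, ?_⟩ <;> simp [summable_zero]
  add_mem' := by
    rintro u v ⟨hu, hu'⟩ ⟨hv, hv'⟩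
    rw [memH1_iff] at hu hv
    refine ⟨memH1_iff.2 ?_, ?_⟩
    · have h1 := summable_weighted_mul (h := fun _ => 1) (u := u) (v := v) (fun _ => zero_le_one)
        (by simpa using hu) (by simpa using hv)
      refine ((hu.add hv).add (h1.mul_left 2)).congr fun x => ?_
      simp only [Pi.add_apply]; ring
    · refine ((hu'.add hv').add ((summable_weighted_mul hh.nonneg hu' hv').mul_left 2)).congr
        fun x => ?_
      simp only [Pi.add_apply]; ring
  smul_mem' := by
    rintro c u ⟨hu, hu'⟩
    rw [memH1_iff] at hu
    refine ⟨memH1_iff.2 ((hu.mul_left (c ^ 2)).congr fun x => ?_),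
      (hu'.mul_left (c ^ 2)).congr fun x => ?_⟩ <;>
    · simp only [Pi.smul_apply, smul_eq_mul]; ring

/-- The space `H`, as a type of its own: it carries the norm defined by `a` and `h` below (and
not the topology of pointwise convergence). -/
def HSpace (a : ℝ) (_ha : 0 < a) (h : V → ℝ) (hh : PosBelow h) : Type := HSub h hh

section HSpace

variable {a : ℝ} {ha : 0 < a} {h : V → ℝ} {hh : PosBelow h}

instance : AddCommGroup (HSpace a ha h hh) := inferInstanceAs (AddCommGroup (HSub h hh))

instance : Module ℝ (HSpace a ha h hh) := inferInstanceAs (Module ℝ (HSub h hh))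

instance : CoeFun (HSpace a ha h hh) (fun _ => V → ℝ) := ⟨fun u => u.1⟩

theorem HSpace.summable_sq (u : HSpace a ha h hh) : Summable fun x => u x ^ 2 :=
  memH1_iff.1 u.2.1

theorem HSpace.summable_form (u v : HSpace a ha h hh) :
    Summable fun x => a * gradForm u v x + h x * (u x * v x) :=
  ((summable_gradForm u.summable_sq v.summable_sq).mul_left a).add
    (summable_weighted_mul hh.nonneg u.2.2 v.2.2)

theorem HSpace.form_self_nonneg (u : HSpace a ha h hh) (x : V) :
    0 ≤ a * gradForm u u x + h x * (u x * u x) :=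
  add_nonneg (mul_nonneg ha.le (gradForm_self_nonneg u x))
    (mul_nonneg (hh.nonneg x) (mul_self_nonneg _))

/-- The inner product `⟨u,v⟩ = ∑ (a ∇u ∇v + h u v)` on `H`. -/
@[reducible] def HSpace.core : InnerProductSpace.Core ℝ (HSpace a ha h hh) where
  inner u v := ∑' x, (a * gradForm u v x + h x * (u x * v x))
  conj_inner_symm u v := by
    simp only [conj_trivial]
    exact tsum_congr fun x => by rw [gradForm_comm, mul_comm (v x)]
  re_inner_nonneg u := tsum_nonneg u.form_self_nonneg
  add_left u v w := by
    rw [← (u.summable_form w).tsum_add (v.summable_form w)]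
    refine tsum_congr fun x => ?_
    have h1 : gradForm (u + v : HSpace a ha h hh) w x = gradForm u w x + gradForm v w x :=
      gradForm_add_left _ _ _ x
    have h2 : (u + v : HSpace a ha h hh) x = u x + v x := rfl
    rw [h1, h2]; ring
  smul_left u v c := by
    simp only [conj_trivial]
    rw [← tsum_mul_left]
    refine tsum_congr fun x => ?_
    have h1 : gradForm (c • u : HSpace a ha h hh) v x = c * gradForm u v x :=
      gradForm_smul_left _ _ _ x
    have h2 : (c • u : HSpace a ha h hh) x = c * u x := rfl
    rw [h1, h2]; ring
  definite u hu := by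
    have h0 := (hasSum_zero_iff_of_nonneg u.form_self_nonneg).1
      ((u.summable_form u).hasSum_iff.2 hu)
    refine Subtype.ext (funext fun x => ?_)
    have hx := congrFun h0 x
    have h1 : 0 ≤ a * gradForm u u x := mul_nonneg ha.le (gradForm_self_nonneg u x)
    have h2 : 0 < h x := hh.pos x
    simp only [Pi.zero_apply] at hx
    have h3 : h x * (u x * u x) ≤ 0 := by linarith
    have h4 : u x * u x ≤ 0 := by
      by_contra hc
      push Not at hc
      exact absurd h3 (not_le.2 (mul_pos h2 hc))
    exact mul_self_eq_zero.1 (le_antisymm h4 (mul_self_nonneg _))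

instance : NormedAddCommGroup (HSpace a ha h hh) := HSpace.core.toNormedAddCommGroup

instance : InnerProductSpace ℝ (HSpace a ha h hh) := InnerProductSpace.ofCore HSpace.core.toCore

/-- The energy functional
`J(u) = ½ ∑ (a|∇u|² + h u²) + (b/4) (∑ |∇u|²)² - (1/2p) ∑ (R_α ∗ |u|^p) |u|^p` on `H`. -/
def energy (b α p : ℝ) (u : HSpace a ha h hh) : ℝ :=
  (1 / 2) * ∑' x, (a * gradForm u u x + h x * u x ^ 2)
    + (b / 4) * (∑' x, gradForm u u x) ^ 2
    - (1 / (2 * p)) * ∑' x, conv α (fun y => |u y| ^ p) x * |u x| ^ p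

/-- The Nehari manifold `{u ∈ H ∖ {0} : (J'(u), u) = 0}`, with `J'` the Fréchet derivative. -/
def nehari (b α p : ℝ) : Set (HSpace a ha h hh) :=
  {u | u ≠ 0 ∧ fderiv ℝ (energy b α p) u u = 0}

/-- `u` is a ground state solution: a critical point of `J` on the Nehari manifold at which `J`
attains `c = inf J` over that manifold. -/
def IsGroundState (b α p : ℝ) (u : HSpace a ha h hh) : Prop :=
  HasFDerivAt (energy b α p) (0 : HSpace a ha h hh →L[ℝ] ℝ) u ∧
  u ∈ nehari b α p ∧
  IsGLB (energy b α p '' (nehari b α p : Set (HSpace a ha h hh))) (energy b α p u)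

/-- `u` satisfies
`-(a + b ∑ |∇u|²) Δu + h u = (R_α ∗ |u|^p) |u|^{p-2} u` at every point of `ℤ³`. -/
def SolvesEquation (b α p : ℝ) (u : HSpace a ha h hh) : Prop :=
  ∀ x, -(a + b * ∑' y, gradForm u u y) * lap u x + h x * u x
    = conv α (fun y => |u y| ^ p) x * |u x| ^ (p - 2) * u x

end HSpace

end KirchhoffChoquard

end

noncomputable section

namespace KirchhoffChoquard

open MeasureTheory Filter Topology

/-! Write `N(u) = ‖u‖²`, `G(u) = ∑ |∇u|²`, `D(u) = ∑ (R_α ∗ |u|^p)|u|^p` and `I(u) = (J'(u), u) = N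
+ b G² - D`. The proof is a direct minimisation of `J` over `I = 0`, `u ≠ 0`.

Since `H ⊂ ℓ² ⊂ ℓ^∞` and `p > 2`, the map `u ↦ |u|^p` is `C¹` from `ℓ²` to `ℓ¹`. A bounded kernel
acts from `ℓ¹` to `ℓ^∞`, so `D` is a bounded symmetric bilinear form composed with a `C¹` map, and
no Hardy–Littlewood–Sobolev inequality is needed. The kernel enters only through its symmetry,
translation invariance, boundedness, decay at infinity (Riemann–Lebesgue) and positivity on the
diagonal.

The terms `N`, `G²`, `D` are homogeneous of degrees `2`, `4` and `2p > 4`. Hence on the manifold `J`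
equals `reducedEnergy`, a combination of `N` and `G²` with positive coefficients, which is coercive
and increases along rays. A nonzero `u` with `I(u) ≤ 0` can moreover be shrunk onto the manifold
(`exists_smul_nehariFun_eq_zero`).

A minimising sequence is therefore bounded, and it cannot vanish uniformly
(`exists_le_abs_apply_of_mem_nehari`). Translating by the period lattice keeps a non-small value in
a fixed finite box, so a subsequence converges pointwise to some `w ≠ 0`. A Brezis–Lieb argument
splits `N` and `D` along `u_n = w + v_n`; the Kirchhoff term splits only as an inequality, in the
useful direction (`exists_splitting`). If `I(w) > 0`, then eventually `I(v_n) < 0`, so `v_n` alone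
already costs the whole infimum and nothing is left for `w`. So `I(w) ≤ 0`, and shrinking `w` onto
the manifold gives a minimiser.

A Lagrange multiplier argument makes the minimiser a critical point, and testing `J'(u) = 0` against
`δ_x` gives the equation at `x`. -/

/-! ### The kernel `R_α`: integrability of the symbol, positivity on the diagonal, boundedness,
decay. -/

theorem integrableOn_two_sub_two_mul_cos_rpow {s : ℝ} (hs : 0 < s) (hs' : s < 1 / 2) :
    IntegrableOn (fun t : ℝ => (2 - 2 * Real.cos t) ^ (-s)) (Set.Ioo 0 (2 * Real.pi)) := by
  have hpi := Real.pi_pos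
  have h1 : IntegrableOn (fun t : ℝ => t ^ (-(2 * s))) (Set.Ioo 0 (2 * Real.pi)) := by
    have := intervalIntegral.intervalIntegrable_rpow' (a := 0) (b := 2 * Real.pi)
      (r := -(2 * s)) (by linarith)
    rw [intervalIntegrable_iff_integrableOn_Ioc_of_le (by positivity)] at this
    exact this.mono_set Set.Ioo_subset_Ioc_self
  have h2 : IntegrableOn (fun t : ℝ => (2 * Real.pi - t) ^ (-(2 * s)))
      (Set.Ioo 0 (2 * Real.pi)) := by
    have := (intervalIntegral.intervalIntegrable_rpow' (a := 0) (b := 2 * Real.pi)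
      (r := -(2 * s)) (by linarith)).comp_sub_left (2 * Real.pi)
    simp only [sub_zero, sub_self] at this
    have := this.symm
    rw [intervalIntegrable_iff_integrableOn_Ioc_of_le (by positivity)] at this
    exact this.mono_set Set.Ioo_subset_Ioc_self
  -- The quadratic bound `2 - 2 cos t ≥ 4t²/π²` controls the singularity at `0`; the reflection `t ↦
  -- 2π - t` transfers it to the one at `2π`.
  have key : ∀ t : ℝ, 0 < t → t ≤ Real.pi →
      (2 - 2 * Real.cos t) ^ (-s) ≤ (4 / Real.pi ^ 2) ^ (-s) * t ^ (-(2 * s)) := by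
    intro t ht ht'
    have h3 := Real.cos_le_one_sub_mul_cos_sq (x := t) (by rw [abs_of_pos ht]; exact ht')
    have h4 : 4 / Real.pi ^ 2 * t ^ 2 ≤ 2 - 2 * Real.cos t := by
      have : 4 / Real.pi ^ 2 * t ^ 2 = 2 * (2 / Real.pi ^ 2 * t ^ 2) := by ring
      linarith
    calc (2 - 2 * Real.cos t) ^ (-s) ≤ (4 / Real.pi ^ 2 * t ^ 2) ^ (-s) :=
          Real.rpow_le_rpow_of_nonpos (by positivity) h4 (by linarith)
      _ = _ := by
          rw [Real.mul_rpow (by positivity) (by positivity), ← Real.rpow_natCast t 2,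
            ← Real.rpow_mul ht.le]
          congr 2
          push_cast
          ring
  refine Integrable.mono' ((h1.add h2).const_mul ((4 / Real.pi ^ 2) ^ (-s))) ?_ ?_
  · exact Measurable.aestronglyMeasurable (by fun_prop)
  · refine (ae_restrict_iff' measurableSet_Ioo).2 (Eventually.of_forall fun t ht => ?_)
    have hc : 0 ≤ 2 - 2 * Real.cos t := by linarith [Real.cos_le_one t]
    rw [Real.norm_of_nonneg (Real.rpow_nonneg hc _)]
    have hp1 : 0 ≤ t ^ (-(2 * s)) := Real.rpow_nonneg ht.1.le _
    have hp2 : 0 ≤ (2 * Real.pi - t) ^ (-(2 * s)) := Real.rpow_nonneg (by linarith [ht.2]) _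
    have hC : 0 ≤ (4 / Real.pi ^ 2) ^ (-s) := by positivity
    simp only [Pi.add_apply, mul_add]
    rcases le_total t Real.pi with h | h
    · exact (key t ht.1 h).trans (le_add_of_nonneg_right (mul_nonneg hC hp2))
    · have := key (2 * Real.pi - t) (by linarith [ht.2]) (by linarith)
      rw [Real.cos_two_pi_sub] at this
      exact this.trans (le_add_of_nonneg_left (mul_nonneg hC hp1))

/-- The interior of the cube `𝕋³`. -/
def openTorus : Set (Fin 3 → ℝ) := Set.univ.pi fun _ => Set.Ioo 0 (2 * Real.pi)

theorem openTorus_ae_eq : openTorus =ᵐ[volume] torus := Measure.univ_pi_Ioo_ae_eq_Icc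

theorem measurableSet_openTorus : MeasurableSet openTorus :=
  MeasurableSet.univ_pi fun _ => measurableSet_Ioo

theorem cos_lt_one_of_mem_Ioo {t : ℝ} (ht : t ∈ Set.Ioo 0 (2 * Real.pi)) : Real.cos t < 1 := by
  refine lt_of_le_of_ne (Real.cos_le_one t) fun h => ?_
  have := (Real.cos_eq_one_iff_of_lt_of_lt (by linarith [ht.1, Real.pi_pos]) ht.2).1 h
  exact ht.1.ne' this

theorem two_sub_two_mul_cos_le_symb (k : Fin 3 → ℝ) (j : Fin 3) :
    2 - 2 * Real.cos (k j) ≤ symb k := by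
  unfold symb
  have h0 := Real.cos_le_one (k 0)
  have h1 := Real.cos_le_one (k 1)
  have h2 := Real.cos_le_one (k 2)
  rw [Fin.sum_univ_three]
  fin_cases j <;> simp <;> linarith

theorem symb_pos {k : Fin 3 → ℝ} (hk : k ∈ openTorus) : 0 < symb k :=
  lt_of_lt_of_le (by linarith [cos_lt_one_of_mem_Ioo (hk 0 (Set.mem_univ _))])
    (two_sub_two_mul_cos_le_symb k 0)

theorem symb_nonneg (k : Fin 3 → ℝ) : 0 ≤ symb k :=
  le_trans (by linarith [Real.cos_le_one (k 0)]) (two_sub_two_mul_cos_le_symb k 0)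

theorem continuous_symb : Continuous symb := by
  unfold symb
  fun_prop

/-- The symbol dominates each `2 - 2 cos k_j`, so writing its power as a product of three equal
powers of exponent `-α/6` bounds it by a product of one-variable functions. Each factor is
integrable exactly because `α/6 < 1/2`. The open cube avoids the zeros of the symbol. -/
theorem integrableOn_symb_rpow_neg {α : ℝ} (hα : 0 < α) (hα' : α < 3) :
    IntegrableOn (fun k => symb k ^ (-(α / 2))) torus := by
  refine IntegrableOn.congr_set_ae ?_ openTorus_ae_eq.symm
  have hprod : IntegrableOn (fun k : Fin 3 → ℝ => ∏ j, (2 - 2 * Real.cos (k j)) ^ (-(α / 6)))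
      openTorus := by
    unfold IntegrableOn openTorus
    rw [volume_pi, Measure.restrict_pi_pi]
    exact Integrable.fintype_prod (f := fun _ t => (2 - 2 * Real.cos t) ^ (-(α / 6)))
      fun _ => integrableOn_two_sub_two_mul_cos_rpow (by positivity) (by linarith)
  refine Integrable.mono' hprod ?_ ?_
  · exact Measurable.aestronglyMeasurable (continuous_symb.measurable.pow_const _)
  · refine (ae_restrict_iff' measurableSet_openTorus).2 (Eventually.of_forall fun k hk => ?_)
    have hs := symb_pos hk
    rw [Real.norm_of_nonneg (Real.rpow_nonneg hs.le _)]
    have h1 : symb k ^ (-(α / 2)) = ∏ _j : Fin 3, symb k ^ (-(α / 6)) := by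
      rw [Finset.prod_const, Finset.card_univ, Fintype.card_fin, ← Real.rpow_natCast,
        ← Real.rpow_mul hs.le]
      congr 1
      push_cast
      ring
    rw [h1]
    refine Finset.prod_le_prod (fun _ _ => Real.rpow_nonneg hs.le _) fun j _ => ?_
    exact Real.rpow_le_rpow_of_nonpos
      (by linarith [cos_lt_one_of_mem_Ioo (hk j (Set.mem_univ _))])
      (two_sub_two_mul_cos_le_symb k j) (by linarith)

theorem setIntegral_symb_rpow_pos {s : ℝ} (hs : IntegrableOn (fun k => symb k ^ s) torus) :
    0 < ∫ k in torus, symb k ^ s := by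
  rw [setIntegral_pos_iff_support_of_nonneg_ae
    (Eventually.of_forall fun k => Real.rpow_nonneg (symb_nonneg k) _) hs]
  refine lt_of_lt_of_le ?_ (measure_mono (s := openTorus) fun k hk => ⟨?_, ?_⟩)
  · refine (isOpen_set_pi Set.finite_univ fun _ _ => isOpen_Ioo).measure_pos _
      ⟨fun _ => Real.pi, fun _ _ => ⟨Real.pi_pos, by linarith [Real.pi_pos]⟩⟩
  · exact (Real.rpow_pos_of_pos (symb_pos hk) _).ne'
  · exact ⟨fun i => (hk i trivial).1.le, fun i => (hk i trivial).2.le⟩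

theorem fracDeg_pos {α : ℝ} (hα : 0 < α) : 0 < fracDeg α := by
  have hi : IntegrableOn (fun k => symb k ^ (α / 2)) torus :=
    (continuous_symb.rpow_const fun _ => Or.inr (by positivity)).continuousOn.integrableOn_compact
      isCompact_Icc
  exact mul_pos (by have := Real.pi_pos; positivity) (setIntegral_symb_rpow_pos hi)

theorem riesz_self_pos {α : ℝ} (hα : 0 < α) (hα' : α < 3) (x : V) : 0 < riesz α x x := by
  unfold riesz
  have h : (∫ k in torus, Complex.exp (Complex.I *
      ((∑ j, ((x j - x j : ℤ) : ℝ) * k j : ℝ) : ℂ)) * ((symb k ^ (-(α / 2)) : ℝ) : ℂ)) =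
      ((∫ k in torus, symb k ^ (-(α / 2)) : ℝ) : ℂ) := by
    rw [← integral_complex_ofReal]
    simp
  rw [h, Complex.ofReal_re]
  exact mul_pos (div_pos (fracDeg_pos hα) (by have := Real.pi_pos; positivity))
    (setIntegral_symb_rpow_pos (integrableOn_symb_rpow_neg hα hα'))

theorem riesz_comm (α : ℝ) (x y : V) : riesz α x y = riesz α y x := by
  unfold riesz
  rw [← Complex.conj_re, ← integral_conj]
  congr 3
  funext k
  rw [map_mul, Complex.conj_ofReal, ← Complex.exp_conj, map_mul, Complex.conj_I,
    Complex.conj_ofReal]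
  congr 2
  rw [neg_mul, ← mul_neg, ← Complex.ofReal_neg, ← Finset.sum_neg_distrib]
  congr 2
  refine Finset.sum_congr rfl fun j _ => ?_
  push_cast
  ring

theorem riesz_add_right (α : ℝ) (x y z : V) : riesz α (x + z) (y + z) = riesz α x y := by
  unfold riesz
  simp only [Pi.add_apply, add_sub_add_right_eq_sub]

theorem riesz_sub_zero (α : ℝ) (x y : V) : riesz α (x - y) 0 = riesz α x y := by
  rw [← riesz_add_right α (x - y) 0 y]
  simp

/-- The exponential has modulus one. No restriction on `α` is needed: if the power of the symbol is
not integrable, both integrals are `0` by convention. The added `1` only makes the constant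
positive. -/
theorem exists_riesz_bound (α : ℝ) : ∃ C : ℝ, 0 < C ∧ ∀ x y, |riesz α x y| ≤ C := by
  refine ⟨|fracDeg α / (2 * Real.pi) ^ 3| * (∫ k in torus, symb k ^ (-(α / 2))) + 1, ?_,
    fun x y => ?_⟩
  · have : 0 ≤ ∫ k in torus, symb k ^ (-(α / 2)) :=
      integral_nonneg fun k => Real.rpow_nonneg (symb_nonneg k) _
    positivity
  · unfold riesz
    rw [abs_mul]
    refine le_trans (mul_le_mul_of_nonneg_left ((Complex.abs_re_le_norm _).trans
      (norm_integral_le_integral_norm _)) (abs_nonneg _)) ?_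
    refine (le_of_eq ?_).trans (le_add_of_nonneg_right zero_le_one)
    congr 2
    funext k
    rw [norm_mul, mul_comm Complex.I, Complex.norm_exp_ofReal_mul_I, one_mul, Complex.norm_real,
      Real.norm_of_nonneg (Real.rpow_nonneg (symb_nonneg k) _)]

/-- The linear functional `k ↦ -(2π)⁻¹ ∑ⱼ tⱼ kⱼ`. -/
def frequency : (Fin 3 → ℝ) →ₗ[ℝ] StrongDual ℝ (Fin 3 → ℝ) where
  toFun t := -(2 * Real.pi)⁻¹ • ∑ j, t j • ContinuousLinearMap.proj (R := ℝ) j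
  map_add' s t := by simp only [Pi.add_apply, add_smul, Finset.sum_add_distrib, smul_add]
  map_smul' c t := by simp [mul_smul, Finset.smul_sum, smul_comm c]

theorem frequency_apply (t k : Fin 3 → ℝ) :
    frequency t k = -(2 * Real.pi)⁻¹ * ∑ j, t j * k j := by
  simp [frequency]

theorem injective_frequency : Function.Injective frequency := by
  intro s t hst
  funext j
  have := congrArg (fun w : StrongDual ℝ (Fin 3 → ℝ) => w (Pi.single j 1)) hst
  simp only [frequency_apply, Pi.single_apply, mul_ite, mul_one, mul_zero, Finset.sum_ite_eq',
    Finset.mem_univ, if_true] at this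
  exact mul_left_cancel₀ (neg_ne_zero.2 (inv_ne_zero (by positivity))) this

theorem tendsto_intCast_cofinite_cocompact :
    Tendsto (fun (x : V) (j : Fin 3) => (x j : ℝ)) cofinite (cocompact (Fin 3 → ℝ)) := by
  rw [← coprodᵢ_cofinite, ← coprodᵢ_cocompact]
  exact Tendsto.pi_map_coprodᵢ fun _ => Int.tendsto_coe_cofinite

/-- This is the Riemann–Lebesgue lemma along the lattice; `frequency` absorbs the sign and the
factor `2π` of the standard character, and being linear and injective it sends lattice points
leaving finite sets to frequencies leaving compact sets. -/
theorem tendsto_riesz_zero (α : ℝ) : Tendsto (fun x : V => riesz α x 0) cofinite (𝓝 0) := by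
  have h1 := tendsto_integral_exp_smul_cocompact
    (torus.indicator fun k : Fin 3 → ℝ => ((symb k ^ (-(α / 2)) : ℝ) : ℂ)) volume
  have h2 : Tendsto frequency (cocompact (Fin 3 → ℝ)) (cocompact (StrongDual ℝ (Fin 3 → ℝ))) :=
    (LinearMap.isClosedEmbedding_of_injective
      (LinearMap.ker_eq_bot.2 injective_frequency)).tendsto_cocompact
  have h3 := h1.comp (h2.comp tendsto_intCast_cofinite_cocompact)
  have h4 := ((Complex.continuous_re.tendsto _).comp h3).const_mul (fracDeg α / (2 * Real.pi) ^ 3)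
  rw [Complex.zero_re, mul_zero] at h4
  refine h4.congr fun x => ?_
  simp only [riesz, Function.comp_apply]
  congr 2
  rw [← integral_indicator (show MeasurableSet torus from measurableSet_Icc)]
  congr 1
  funext k
  by_cases hk : k ∈ torus
  · rw [Set.indicator_of_mem hk, Set.indicator_of_mem hk, Circle.smul_def,
      Real.fourierChar_apply, smul_eq_mul, frequency_apply]
    congr 2
    rw [mul_comm]
    congr 1
    have := Real.pi_pos.ne'
    simp only [Pi.zero_apply, sub_zero]
    congr 1
    field_simp
  · rw [Set.indicator_of_notMem hk, Set.indicator_of_notMem hk, smul_zero]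

/-! ### Scalar inequalities for `|s|^p` and its derivative. -/

/-- The odd power `|s|^{p-2} s`. -/
def oddPow (p s : ℝ) : ℝ := |s| ^ (p - 2) * s

theorem oddPow_of_nonneg {p s : ℝ} (hp : 2 < p) (hs : 0 ≤ s) : oddPow p s = s ^ (p - 1) := by
  unfold oddPow
  rw [abs_of_nonneg hs]
  rcases hs.eq_or_lt with rfl | hs'
  · rw [mul_zero, Real.zero_rpow (by linarith)]
  · nth_rw 2 [← Real.rpow_one s]
    rw [← Real.rpow_add hs']
    congr 1
    ring

theorem oddPow_neg (p s : ℝ) : oddPow p (-s) = -oddPow p s := by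
  simp [oddPow]

theorem oddPow_mul_self {p : ℝ} (hp : 2 < p) (s : ℝ) : oddPow p s * s = |s| ^ p := by
  unfold oddPow
  rw [mul_assoc, ← abs_mul_abs_self s, ← mul_assoc]
  rcases eq_or_ne s 0 with rfl | hs
  · simp [Real.zero_rpow (show p ≠ 0 by linarith)]
  · have h : |s| ^ p = |s| ^ (p - 2 + 2) := by congr 1; ring
    rw [h, Real.rpow_add (abs_pos.2 hs), Real.rpow_two]
    ring

theorem abs_oddPow_le {p s M : ℝ} (hp : 2 < p) (hs : |s| ≤ M) :
    |oddPow p s| ≤ M ^ (p - 2) * |s| := by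
  unfold oddPow
  rw [abs_mul, abs_of_nonneg (Real.rpow_nonneg (abs_nonneg s) _)]
  exact mul_le_mul_of_nonneg_right
    (Real.rpow_le_rpow (abs_nonneg s) hs (by linarith)) (abs_nonneg s)

theorem abs_rpow_le {p s M : ℝ} (hp : 2 < p) (hs : |s| ≤ M) : |s| ^ p ≤ M ^ (p - 2) * s ^ 2 := by
  rw [← oddPow_mul_self hp]
  calc oddPow p s * s ≤ |oddPow p s * s| := le_abs_self _
    _ = |oddPow p s| * |s| := abs_mul _ _
    _ ≤ M ^ (p - 2) * |s| * |s| := mul_le_mul_of_nonneg_right (abs_oddPow_le hp hs) (abs_nonneg s)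
    _ = M ^ (p - 2) * s ^ 2 := by rw [mul_assoc, abs_mul_abs_self, sq]

/-- For equal signs this is the mean value inequality for `z ^ (p - 1)` on `[0, M]`. For opposite
signs `|t - s| = |t| + |s|`, and the linear bound `abs_oddPow_le` suffices because `p - 1 ≥ 1`. -/
theorem abs_oddPow_sub_le {p M s t : ℝ} (hp : 2 < p) (hs : |s| ≤ M) (ht : |t| ≤ M) :
    |oddPow p t - oddPow p s| ≤ (p - 1) * M ^ (p - 2) * |t - s| := by
  have hM : 0 ≤ M := (abs_nonneg s).trans hs
  have hMp : 0 ≤ M ^ (p - 2) := Real.rpow_nonneg hM _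
  have same : ∀ x y : ℝ, 0 ≤ x → 0 ≤ y → x ≤ M → y ≤ M →
      |oddPow p y - oddPow p x| ≤ (p - 1) * M ^ (p - 2) * |y - x| := by
    intro x y hx hy hxM hyM
    rw [oddPow_of_nonneg hp hx, oddPow_of_nonneg hp hy]
    refine Convex.norm_image_sub_le_of_norm_hasDerivWithin_le (f := fun z : ℝ => z ^ (p - 1))
      (s := Set.Icc 0 M) (f' := fun z => (p - 1) * z ^ (p - 1 - 1))
      (fun z _ => (Real.hasDerivAt_rpow_const (Or.inr (by linarith))).hasDerivWithinAt)
      (fun z hz => ?_) (convex_Icc 0 M) ⟨hx, hxM⟩ ⟨hy, hyM⟩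
    have h1 : p - 1 - 1 = p - 2 := by ring
    rw [h1, norm_mul, Real.norm_of_nonneg (by linarith),
      Real.norm_of_nonneg (Real.rpow_nonneg hz.1 _)]
    exact mul_le_mul_of_nonneg_left (Real.rpow_le_rpow hz.1 hz.2 (by linarith)) (by linarith)
  have opp : ∀ x y : ℝ, x ≤ 0 → 0 ≤ y → |x| ≤ M → |y| ≤ M →
      |oddPow p y - oddPow p x| ≤ (p - 1) * M ^ (p - 2) * |y - x| := by
    intro x y hx hy hxM hyM
    calc |oddPow p y - oddPow p x| ≤ |oddPow p y| + |oddPow p x| := abs_sub _ _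
      _ ≤ M ^ (p - 2) * |y| + M ^ (p - 2) * |x| :=
        add_le_add (abs_oddPow_le hp hyM) (abs_oddPow_le hp hxM)
      _ = M ^ (p - 2) * |y - x| := by
        rw [abs_of_nonneg hy, abs_of_nonpos hx, abs_of_nonneg (by linarith : 0 ≤ y - x)]
        ring
      _ ≤ (p - 1) * M ^ (p - 2) * |y - x| := by
        refine mul_le_mul_of_nonneg_right ?_ (abs_nonneg _)
        nlinarith
  rcases le_total 0 s with h1 | h1 <;> rcases le_total 0 t with h2 | h2
  · exact same s t h1 h2 ((le_abs_self _).trans hs) ((le_abs_self _).trans ht)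
  · rw [abs_sub_comm, abs_sub_comm t]
    exact opp t s h2 h1 ht hs
  · exact opp s t h1 h2 hs ht
  · have := same (-s) (-t) (by linarith) (by linarith) ((neg_le_abs _).trans hs)
      ((neg_le_abs _).trans ht)
    rw [oddPow_neg, oddPow_neg] at this
    rw [abs_sub_comm, abs_sub_comm t]
    convert this using 2 <;> ring_nf

/-- Subtracting the tangent line leaves a function whose derivative on the segment is small by the
Lipschitz bound for `oddPow`; the mean value inequality then gives a quadratic remainder. -/
theorem abs_rpow_taylor_le {p M s t : ℝ} (hp : 2 < p) (hs : |s| ≤ M) (ht : |t| ≤ M) :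
    |(|t| ^ p - |s| ^ p - p * oddPow p s * (t - s))| ≤ p * (p - 1) * M ^ (p - 2) * (t - s) ^ 2 := by
  have hd : ∀ z ∈ Set.uIcc s t, HasDerivWithinAt (fun z : ℝ => |z| ^ p - p * oddPow p s * z)
      (p * oddPow p z - p * oddPow p s) (Set.uIcc s t) z := by
    intro z _
    have h1 := (hasDerivAt_abs_rpow z (by linarith : 1 < p)).sub
      ((hasDerivAt_id z).const_mul (p * oddPow p s))
    refine (h1.congr_deriv ?_).hasDerivWithinAt
    simp only [oddPow]
    ring
  have hb : ∀ z ∈ Set.uIcc s t, ‖p * oddPow p z - p * oddPow p s‖ ≤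
      p * (p - 1) * M ^ (p - 2) * |t - s| := by
    intro z hz
    have hzM : |z| ≤ M := by
      rw [abs_le] at hs ht ⊢
      rw [Set.mem_uIcc] at hz
      rcases hz with hz | hz <;> constructor <;> linarith [hz.1, hz.2]
    have hMp : 0 ≤ M ^ (p - 2) := Real.rpow_nonneg ((abs_nonneg s).trans hs) _
    rw [← mul_sub, norm_mul, Real.norm_of_nonneg (by linarith), mul_assoc, mul_assoc]
    refine mul_le_mul_of_nonneg_left ?_ (by linarith)
    refine (abs_oddPow_sub_le hp hs hzM).trans ?_
    rw [mul_assoc]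
    refine mul_le_mul_of_nonneg_left (mul_le_mul_of_nonneg_left ?_ hMp) (by linarith)
    exact Set.abs_sub_left_of_mem_uIcc hz
  have := Convex.norm_image_sub_le_of_norm_hasDerivWithin_le hd hb (convex_uIcc s t)
    Set.left_mem_uIcc Set.right_mem_uIcc
  rw [Real.norm_eq_abs, Real.norm_eq_abs] at this
  calc _ = |(|t| ^ p - p * oddPow p s * t - (|s| ^ p - p * oddPow p s * s))| := by congr 1; ring
    _ ≤ p * (p - 1) * M ^ (p - 2) * |t - s| * |t - s| := this
    _ = _ := by rw [mul_assoc _ |t - s|, abs_mul_abs_self, sq]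

/-- The error in `|s + t|^p ≈ |s|^p + |t|^p` is an arbitrarily small multiple of `t²`, up to a
multiple of `s²`. -/
theorem exists_abs_rpow_add_sub_le {p M η : ℝ} (hp : 2 < p) (hM : 0 ≤ M) (hη : 0 < η) :
    ∃ C : ℝ, 0 ≤ C ∧ ∀ s t : ℝ, |s| ≤ M → |t| ≤ M → |s + t| ≤ M →
      |(|s + t| ^ p - |s| ^ p - |t| ^ p)| ≤ η * t ^ 2 + C * s ^ 2 := by
  set K := M ^ (p - 2) with hK
  have hK0 : 0 ≤ K := Real.rpow_nonneg hM _
  refine ⟨p * (p - 1) * K + (p * K) ^ 2 / (4 * η) + K, ?_, fun s t hs ht hst => ?_⟩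
  · have : 0 ≤ p * (p - 1) * K := mul_nonneg (by nlinarith) hK0
    positivity
  · have h1 := abs_rpow_taylor_le hp ht hst
    rw [add_sub_cancel_right] at h1
    have h2 := abs_rpow_le hp hs
    have h3 : |p * oddPow p t * s| ≤ p * K * |t| * |s| := by
      rw [abs_mul, abs_mul, abs_of_pos (by linarith : 0 < p)]
      refine mul_le_mul_of_nonneg_right ?_ (abs_nonneg s)
      rw [mul_assoc]
      exact mul_le_mul_of_nonneg_left (abs_oddPow_le hp ht) (by linarith)
    have h4 : p * K * |t| * |s| ≤ η * t ^ 2 + (p * K) ^ 2 / (4 * η) * s ^ 2 := by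
      have h5 : η * t ^ 2 + (p * K) ^ 2 / (4 * η) * s ^ 2 - p * K * |t| * |s| =
          (2 * η * |t| - p * K * |s|) ^ 2 / (4 * η) := by
        rw [← sq_abs t, ← sq_abs s]
        field_simp
        ring
      have : 0 ≤ (2 * η * |t| - p * K * |s|) ^ 2 / (4 * η) := by positivity
      linarith
    have h6 : 0 ≤ |s| ^ p := Real.rpow_nonneg (abs_nonneg s) _
    rw [abs_le] at h1 h3 ⊢
    constructor <;> nlinarith [h1.1, h1.2, h3.1, h3.2]

/-! ### Sequence spaces and the power maps between them. -/

/-- The Banach spaces `ℓ^q(ℤ³)`. -/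
abbrev Ell (q : ENNReal) : Type := lp (fun _ : V => ℝ) q

theorem memℓp_one_iff {f : V → ℝ} : Memℓp f 1 ↔ Summable fun x => |f x| := by
  rw [memℓp_gen_iff (by simp)]
  simp

theorem memℓp_two_iff {f : V → ℝ} : Memℓp f 2 ↔ Summable fun x => f x ^ 2 := by
  rw [memℓp_gen_iff (by simp)]
  simp

theorem Ell.summable_abs (f : Ell 1) : Summable fun x => |f x| := memℓp_one_iff.1 (lp.memℓp f)

theorem Ell.summable (f : Ell 1) : Summable fun x => f x := f.summable_abs.of_abs

theorem Ell.summable_sq (f : Ell 2) : Summable fun x => f x ^ 2 := memℓp_two_iff.1 (lp.memℓp f)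

theorem Ell.norm_eq_tsum (f : Ell 1) : ‖f‖ = ∑' x, |f x| := by
  have := lp.norm_rpow_eq_tsum (p := 1) (by simp) f
  simpa using this

theorem Ell.norm_sq_eq_tsum (f : Ell 2) : ‖f‖ ^ 2 = ∑' x, f x ^ 2 := by
  have := lp.norm_rpow_eq_tsum (p := 2) (by simp) f
  simpa using this

theorem Ell.abs_apply_le (f : Ell 2) (x : V) : |f x| ≤ ‖f‖ := lp.norm_apply_le_norm (by simp) f x

theorem Ell.norm_le_of_abs_le_sq {f : Ell 1} {w : Ell 2} {C : ℝ}
    (h : ∀ x, |f x| ≤ C * w x ^ 2) : ‖f‖ ≤ C * ‖w‖ ^ 2 := by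
  rw [f.norm_eq_tsum, w.norm_sq_eq_tsum, ← tsum_mul_left]
  exact f.summable_abs.tsum_le_tsum h (w.summable_sq.mul_left C)

/-- Pointwise multiplication `ℓ² × ℓ² → ℓ¹`. -/
def mulEll : Ell 2 →L[ℝ] Ell 2 →L[ℝ] Ell 1 :=
  lp.holderL 1 (fun _ => ContinuousLinearMap.mul ℝ ℝ) (K := 1)
    (fun _ => ContinuousLinearMap.opNorm_mul_le ℝ ℝ)

theorem mulEll_apply (u v : Ell 2) (x : V) : mulEll u v x = u x * v x := rfl

section Power

variable {p : ℝ} (hp : 2 < p)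

/-- The map `u ↦ |u|^p` from `ℓ²` to `ℓ¹`. -/
def powEll (u : Ell 2) : Ell 1 :=
  ⟨fun x => |u x| ^ p, memℓp_one_iff.2 (Summable.of_nonneg_of_le (fun _ => abs_nonneg _)
    (fun x => by
      rw [abs_of_nonneg (Real.rpow_nonneg (abs_nonneg _) _)]
      exact abs_rpow_le hp (u.abs_apply_le x)) (u.summable_sq.mul_left (‖u‖ ^ (p - 2))))⟩

theorem powEll_apply (u : Ell 2) (x : V) : powEll hp u x = |u x| ^ p := rfl

/-- The map `u ↦ |u|^{p-2} u` from `ℓ²` to `ℓ²`. -/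
def oddPowEll (u : Ell 2) : Ell 2 :=
  ⟨fun x => oddPow p (u x), memℓp_two_iff.2 (Summable.of_nonneg_of_le (fun _ => sq_nonneg _)
    (fun x => by
      have h := abs_oddPow_le hp (u.abs_apply_le x)
      rw [← sq_abs]
      calc |oddPow p (u x)| ^ 2 ≤ (‖u‖ ^ (p - 2) * |u x|) ^ 2 := by gcongr
        _ = (‖u‖ ^ (p - 2)) ^ 2 * u x ^ 2 := by rw [mul_pow, sq_abs])
    (u.summable_sq.mul_left ((‖u‖ ^ (p - 2)) ^ 2)))⟩

theorem continuous_oddPowEll : Continuous (oddPowEll hp) := by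
  refine continuous_iff_continuousAt.2 fun u => ?_
  refine continuousAt_of_locally_lipschitz one_pos ((p - 1) * (‖u‖ + 1) ^ (p - 2)) fun v hv => ?_
  rw [dist_eq_norm] at hv
  rw [dist_eq_norm, dist_eq_norm]
  have hv' : ‖v‖ ≤ ‖u‖ + 1 := by
    have := norm_le_norm_add_norm_sub u v
    rw [norm_sub_rev] at this
    linarith
  have hC : 0 ≤ (p - 1) * (‖u‖ + 1) ^ (p - 2) := by
    have : 0 ≤ p - 1 := by linarith
    positivity
  calc ‖oddPowEll hp v - oddPowEll hp u‖ ≤ ‖((p - 1) * (‖u‖ + 1) ^ (p - 2)) • (v - u)‖ := by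
        refine lp.norm_mono (by simp) fun x => ?_
        rw [lp.coeFn_smul, Pi.smul_apply, smul_eq_mul, norm_mul, Real.norm_of_nonneg hC]
        exact abs_oddPow_sub_le hp ((u.abs_apply_le x).trans (by linarith))
          ((v.abs_apply_le x).trans hv')
    _ = _ := by rw [norm_smul, Real.norm_of_nonneg hC]

/-- On a unit ball the coordinates are uniformly bounded, so the pointwise quadratic Taylor
remainder sums to a multiple of `‖v - u‖²` in the `ℓ¹` norm. -/
theorem hasFDerivAt_powEll (u : Ell 2) :
    HasFDerivAt (powEll hp) (p • mulEll (oddPowEll hp u)) u := by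
  refine HasFDerivAt.of_isLittleO (Asymptotics.IsBigO.trans_isLittleO ?_
    (Asymptotics.isLittleO_pow_sub_sub u one_lt_two))
  refine Asymptotics.IsBigO.of_bound (p * (p - 1) * (‖u‖ + 1) ^ (p - 2)) ?_
  filter_upwards [Metric.ball_mem_nhds u one_pos] with v hv
  rw [Metric.mem_ball, dist_eq_norm] at hv
  have hv' : ‖v‖ ≤ ‖u‖ + 1 := by
    have := norm_le_norm_add_norm_sub u v
    rw [norm_sub_rev] at this
    linarith
  rw [norm_pow, norm_norm]
  refine Ell.norm_le_of_abs_le_sq fun x => ?_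
  have h := abs_rpow_taylor_le hp ((u.abs_apply_le x).trans (by linarith : ‖u‖ ≤ ‖u‖ + 1))
    ((v.abs_apply_le x).trans hv')
  rw [mul_assoc p (oddPow p _)] at h
  exact h

theorem contDiff_powEll : ContDiff ℝ 1 (powEll hp) :=
  contDiff_one_iff_hasFDerivAt.2 ⟨_,
    (mulEll.continuous.comp (continuous_oddPowEll hp)).const_smul p, hasFDerivAt_powEll hp⟩

end Power

/-! ### Convolution with `R_α` as a bilinear form on `ℓ¹`. -/

section Convolution

variable (α : ℝ)

theorem summable_riesz_mul (f : Ell 1) (x : V) : Summable fun y => riesz α x y * f y := by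
  obtain ⟨C, _, hC⟩ := exists_riesz_bound α
  refine Summable.of_norm_bounded (f.summable_abs.mul_left C) fun y => ?_
  rw [norm_mul]
  exact mul_le_mul_of_nonneg_right (hC x y) (abs_nonneg _)

theorem abs_conv_le {C : ℝ} (hC : ∀ x y, |riesz α x y| ≤ C) (f : Ell 1) (x : V) :
    |conv α f x| ≤ C * ‖f‖ := by
  rw [f.norm_eq_tsum, ← tsum_mul_left]
  refine tsum_of_norm_bounded (E := ℝ) (f.summable_abs.mul_left C).hasSum fun y => ?_
  rw [norm_mul]
  exact mul_le_mul_of_nonneg_right (hC x y) (abs_nonneg _)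

/-- The convolution with `R_α` as a bounded operator `ℓ¹ → ℓ^∞`. -/
def convEll : Ell 1 →L[ℝ] Ell ⊤ :=
  LinearMap.mkContinuous
    { toFun f := ⟨conv α f, memℓp_infty ⟨(exists_riesz_bound α).choose * ‖f‖, by
        rintro _ ⟨x, rfl⟩
        exact abs_conv_le α (exists_riesz_bound α).choose_spec.2 f x⟩⟩
      map_add' f g := by
        ext x
        change conv α (f + g : Ell 1) x = conv α f x + conv α g x
        simp only [conv, lp.coeFn_add, Pi.add_apply, mul_add]
        exact (summable_riesz_mul α f x).tsum_add (summable_riesz_mul α g x)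
      map_smul' c f := by
        ext x
        change conv α (c • f : Ell 1) x = c * conv α f x
        simp only [conv, lp.coeFn_smul, Pi.smul_apply, smul_eq_mul, ← tsum_mul_left]
        exact tsum_congr fun y => by ring }
    (exists_riesz_bound α).choose fun f =>
      lp.norm_le_of_forall_le
        (mul_nonneg (exists_riesz_bound α).choose_spec.1.le (norm_nonneg f)) fun x =>
          abs_conv_le α (exists_riesz_bound α).choose_spec.2 f x

/-- The bilinear form `B(f, g) = ∑ (R_α ∗ f) g` on `ℓ¹`. -/
def rieszForm : Ell 1 →L[ℝ] Ell 1 →L[ℝ] ℝ :=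
  (ContinuousLinearMap.compL ℝ (Ell 1) (Ell 1) ℝ (lp.tsumCLM ℝ V ℝ)).comp
    ((lp.holderL 1 (fun _ => ContinuousLinearMap.mul ℝ ℝ) (K := 1)
      (fun _ => ContinuousLinearMap.opNorm_mul_le ℝ ℝ) :
        Ell ⊤ →L[ℝ] Ell 1 →L[ℝ] Ell 1).comp (convEll α))

theorem rieszForm_apply (f g : Ell 1) : rieszForm α f g = ∑' x, conv α f x * g x := rfl

theorem rieszForm_comm (f g : Ell 1) : rieszForm α f g = rieszForm α g f := by
  rw [rieszForm_apply, rieszForm_apply]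
  simp only [conv, ← tsum_mul_right]
  obtain ⟨C, _, hC⟩ := exists_riesz_bound α
  have hs : Summable (Function.uncurry fun x y => riesz α x y * g y * f x) := by
    have h1 := (f.summable_abs.mul_of_nonneg g.summable_abs (fun _ => abs_nonneg _)
      fun _ => abs_nonneg _).mul_left C
    refine Summable.of_norm_bounded h1 fun z => ?_
    simp only [Function.uncurry, norm_mul, Real.norm_eq_abs]
    have := mul_le_mul_of_nonneg_right (hC z.1 z.2)
      (mul_nonneg (abs_nonneg (f z.1)) (abs_nonneg (g z.2)))
    linarith
  rw [← hs.tsum_comm]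
  refine tsum_congr fun x => tsum_congr fun y => ?_
  rw [riesz_comm]
  ring

/-- Dominated convergence in `y`: each translate of the kernel decays, and `C |f|` dominates. That
`R_α ∗ f` lies in `c₀`, and not merely in `ℓ^∞`, is what removes cross terms in the splitting. -/
theorem tendsto_conv_zero (f : Ell 1) : Tendsto (conv α f) cofinite (𝓝 0) := by
  obtain ⟨C, _, hC⟩ := exists_riesz_bound α
  have h := tendsto_tsum_of_dominated_convergence (𝓕 := cofinite)
    (f := fun x y => riesz α x y * f y) (g := fun _ => 0) (f.summable_abs.mul_left C)
    (fun y => ?_) (Eventually.of_forall fun x y => ?_)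
  · rwa [tsum_zero] at h
  · have h1 : Tendsto (fun x : V => x - y) cofinite cofinite :=
      (sub_left_injective (b := y)).tendsto_cofinite
    have h2 := ((tendsto_riesz_zero α).comp h1).mul_const (f y)
    rw [zero_mul] at h2
    exact h2.congr fun x => by rw [Function.comp_apply, riesz_sub_zero]
  · rw [norm_mul]
    exact mul_le_mul_of_nonneg_right (hC x y) (abs_nonneg _)

end Convolution

/-! ### Differential calculus of the energy on `H`. -/

/-- A bilinear form with `|Q(u,v)| ≤ C (‖u‖² + ‖v‖²)` satisfies `|Q(u,v)| ≤ 2 C ‖u‖ ‖v‖`. -/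
theorem abs_bilin_le_of_abs_le_sq_add_sq {E : Type*} [NormedAddCommGroup E] [NormedSpace ℝ E]
    {Q : E →ₗ[ℝ] E →ₗ[ℝ] ℝ} {C : ℝ} (hQ : ∀ u v, |Q u v| ≤ C * (‖u‖ ^ 2 + ‖v‖ ^ 2)) (u v : E) :
    |Q u v| ≤ 2 * C * ‖u‖ * ‖v‖ := by
  rcases eq_or_ne u 0 with rfl | hu
  · simp
  rcases eq_or_ne v 0 with rfl | hv
  · simp
  have hu' : 0 < ‖u‖ := norm_pos_iff.2 hu
  have hv' : 0 < ‖v‖ := norm_pos_iff.2 hv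
  have h := hQ (‖u‖⁻¹ • u) (‖v‖⁻¹ • v)
  rw [norm_smul, norm_smul, norm_inv, norm_inv, norm_norm, norm_norm, inv_mul_cancel₀ hu'.ne',
    inv_mul_cancel₀ hv'.ne', map_smul, map_smul, LinearMap.smul_apply, smul_eq_mul, smul_eq_mul,
    abs_mul, abs_mul, abs_inv, abs_inv, abs_norm, abs_norm] at h
  field_simp at h
  linarith

theorem hasFDerivAt_quadratic {E F : Type*} [NormedAddCommGroup E] [NormedSpace ℝ E]
    [NormedAddCommGroup F] [NormedSpace ℝ F] {B : F →L[ℝ] F →L[ℝ] ℝ} (hB : ∀ x y, B x y = B y x)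
    {f : E → F} {f' : E →L[ℝ] F} {u : E} (hf : HasFDerivAt f f' u) :
    HasFDerivAt (fun v => B (f v) (f v)) ((2 : ℝ) • (B (f u)).comp f') u := by
  refine (B.hasFDerivAt_of_bilinear hf hf).congr_fderiv ?_
  ext v
  simp [ContinuousLinearMap.precompR, ContinuousLinearMap.precompL, hB (f' v), two_mul]

section HSpace

variable {a : ℝ} {ha : 0 < a} {h : V → ℝ} {hh : PosBelow h}

namespace HSpace

theorem ext {u v : HSpace a ha h hh} (huv : ∀ x, u x = v x) : u = v :=
  Subtype.ext (funext huv)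

theorem add_apply (u v : HSpace a ha h hh) (x : V) : (u + v) x = u x + v x := rfl

theorem sub_apply (u v : HSpace a ha h hh) (x : V) : (u - v) x = u x - v x := rfl

theorem smul_apply (c : ℝ) (u : HSpace a ha h hh) (x : V) : (c • u) x = c * u x := rfl

theorem zero_apply (x : V) : (0 : HSpace a ha h hh) x = 0 := rfl

theorem inner_eq_tsum (u v : HSpace a ha h hh) :
    inner ℝ u v = ∑' x, (a * gradForm u v x + h x * (u x * v x)) := rfl

theorem norm_sq_eq_tsum (u : HSpace a ha h hh) :
    ‖u‖ ^ 2 = ∑' x, (a * gradForm u u x + h x * u x ^ 2) := by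
  rw [← real_inner_self_eq_norm_sq, inner_eq_tsum]
  simp only [sq]

theorem norm_sq_eq_add (u : HSpace a ha h hh) :
    ‖u‖ ^ 2 = a * ∑' x, gradForm u u x + ∑' x, h x * u x ^ 2 := by
  rw [norm_sq_eq_tsum, Summable.tsum_add ((summable_gradForm_self u.summable_sq).mul_left a) u.2.2,
    tsum_mul_left]

theorem tsum_gradForm_nonneg (u : HSpace a ha h hh) : 0 ≤ ∑' x, gradForm u u x :=
  tsum_nonneg (gradForm_self_nonneg u)

theorem tsum_weighted_le (u : HSpace a ha h hh) : ∑' x, h x * u x ^ 2 ≤ ‖u‖ ^ 2 := by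
  rw [norm_sq_eq_add]
  exact le_add_of_nonneg_left (mul_nonneg ha.le u.tsum_gradForm_nonneg)

theorem tsum_gradForm_le (u : HSpace a ha h hh) : ∑' x, gradForm u u x ≤ a⁻¹ * ‖u‖ ^ 2 := by
  have h1 : 0 ≤ ∑' x, h x * u x ^ 2 :=
    tsum_nonneg fun x => mul_nonneg (hh.nonneg x) (sq_nonneg _)
  rw [norm_sq_eq_add, mul_add, inv_mul_cancel_left₀ ha.ne']
  exact le_add_of_nonneg_right (mul_nonneg (inv_nonneg.2 ha.le) h1)

theorem tsum_sq_le {h₀ : ℝ} (h₀pos : 0 < h₀) (hle : ∀ x, h₀ ≤ h x) (u : HSpace a ha h hh) :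
    ∑' x, u x ^ 2 ≤ h₀⁻¹ * ‖u‖ ^ 2 := by
  rw [le_inv_mul_iff₀ h₀pos, ← tsum_mul_left]
  refine le_trans ?_ u.tsum_weighted_le
  exact (u.summable_sq.mul_left h₀).tsum_le_tsum
    (fun x => mul_le_mul_of_nonneg_right (hle x) (sq_nonneg _)) u.2.2

/-- The inclusion `H → ℓ²`. -/
def toEll : HSpace a ha h hh →L[ℝ] Ell 2 :=
  LinearMap.mkContinuous
    { toFun u := ⟨u.1, memℓp_two_iff.2 u.summable_sq⟩
      map_add' _ _ := rfl
      map_smul' _ _ := rfl }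
    (Real.sqrt hh.choose⁻¹) fun u => by
      have h1 := u.tsum_sq_le hh.choose_spec.1 hh.choose_spec.2
      refine le_of_sq_le_sq ?_ (by positivity)
      rw [mul_pow, Real.sq_sqrt (inv_nonneg.2 hh.choose_spec.1.le), Ell.norm_sq_eq_tsum]
      exact h1

theorem toEll_apply (u : HSpace a ha h hh) (x : V) : toEll u x = u x := rfl

/-- The form `∑ ∇u ∇v` on `H`. -/
def gradL : HSpace a ha h hh →L[ℝ] HSpace a ha h hh →L[ℝ] ℝ :=
  LinearMap.mkContinuous₂
    (LinearMap.mk₂ ℝ (fun u v => ∑' x, gradForm u v x)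
      (fun u v w => by
        rw [← (summable_gradForm u.summable_sq w.summable_sq).tsum_add
          (summable_gradForm v.summable_sq w.summable_sq)]
        exact tsum_congr fun x => gradForm_add_left _ _ _ x)
      (fun c u w => by
        rw [smul_eq_mul, ← tsum_mul_left]
        exact tsum_congr fun x => gradForm_smul_left _ _ _ x)
      (fun u v w => by
        simp only [gradForm_comm u]
        rw [← (summable_gradForm v.summable_sq u.summable_sq).tsum_add
          (summable_gradForm w.summable_sq u.summable_sq)]
        exact tsum_congr fun x => gradForm_add_left _ _ _ x)
      (fun c u w => by
        simp only [gradForm_comm u]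
        rw [smul_eq_mul, ← tsum_mul_left]
        exact tsum_congr fun x => gradForm_smul_left _ _ _ x))
    (2 * a⁻¹) (abs_bilin_le_of_abs_le_sq_add_sq fun u v => by
      have hu := summable_gradForm_self u.summable_sq
      have hv := summable_gradForm_self v.summable_sq
      have h1 : |∑' x, gradForm u v x| ≤ ∑' x, (gradForm u u x + gradForm v v x) :=
        tsum_of_norm_bounded (E := ℝ) (hu.add hv).hasSum (abs_gradForm_le u v)
      rw [hu.tsum_add hv] at h1
      rw [mul_add]
      exact h1.trans (add_le_add u.tsum_gradForm_le v.tsum_gradForm_le))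

theorem gradL_apply (u v : HSpace a ha h hh) : gradL u v = ∑' x, gradForm u v x := rfl

theorem gradL_comm (u v : HSpace a ha h hh) : gradL u v = gradL v u := by
  simp only [gradL_apply, gradForm_comm u]

theorem gradL_self_nonneg (u : HSpace a ha h hh) : 0 ≤ gradL u u := u.tsum_gradForm_nonneg

end HSpace

open KirchhoffChoquard.HSpace

variable {b p : ℝ} (α : ℝ) (hp : 2 < p)

/-- The nonlocal term `∑ (R_α ∗ |u|^p) |u|^p`. -/
def nonlocal (u : HSpace a ha h hh) : ℝ :=
  rieszForm α (powEll hp (toEll u)) (powEll hp (toEll u))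

theorem energy_eq (u : HSpace a ha h hh) :
    energy b α p u = 1 / 2 * ‖u‖ ^ 2 + b / 4 * gradL u u ^ 2 - 1 / (2 * p) * nonlocal α hp u := by
  rw [norm_sq_eq_tsum]
  rfl

theorem hasFDerivAt_norm_sq (u : HSpace a ha h hh) :
    HasFDerivAt (fun v : HSpace a ha h hh => ‖v‖ ^ 2) ((2 : ℝ) • innerSL ℝ u) u :=
  (hasStrictFDerivAt_norm_sq u).hasFDerivAt.congr_fderiv (by ext v; simp)

theorem hasFDerivAt_gradL (u : HSpace a ha h hh) :
    HasFDerivAt (fun v : HSpace a ha h hh => gradL v v) ((2 : ℝ) • gradL u) u :=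
  (hasFDerivAt_quadratic gradL_comm (hasFDerivAt_id u)).congr_fderiv (by ext v; simp)

theorem hasFDerivAt_nonlocal (u : HSpace a ha h hh) :
    HasFDerivAt (nonlocal α hp) ((2 * p) • (rieszForm α (powEll hp (toEll u))).comp
      ((mulEll (oddPowEll hp (toEll u))).comp toEll)) u := by
  refine (hasFDerivAt_quadratic (rieszForm_comm α)
    ((hasFDerivAt_powEll hp (toEll u)).comp u toEll.hasFDerivAt)).congr_fderiv ?_
  ext v
  simp [mul_assoc]

theorem contDiff_nonlocal : ContDiff ℝ 1 (nonlocal α hp : HSpace a ha h hh → ℝ) := by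
  have h1 : ContDiff ℝ 1 fun u : HSpace a ha h hh => powEll hp (toEll u) :=
    (contDiff_powEll hp).comp toEll.contDiff
  exact ((rieszForm α).contDiff.comp h1).clm_apply h1

theorem contDiff_gradL : ContDiff ℝ 1 fun u : HSpace a ha h hh => gradL u u :=
  gradL.contDiff.clm_apply contDiff_id

theorem contDiff_energy (hp : 2 < p) :
    ContDiff ℝ 1 (energy b α p : HSpace a ha h hh → ℝ) := by
  rw [show (energy b α p : HSpace a ha h hh → ℝ) = _ from funext (energy_eq α hp)]
  exact ((contDiff_const.mul (contDiff_id.norm_sq ℝ)).add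
    (contDiff_const.mul (contDiff_gradL.pow 2))).sub (contDiff_const.mul (contDiff_nonlocal α hp))

theorem hasFDerivAt_energy (u : HSpace a ha h hh) :
    HasFDerivAt (energy b α p) (innerSL ℝ u + (b * gradL u u) • gradL u -
      (rieszForm α (powEll hp (toEll u))).comp
        ((mulEll (oddPowEll hp (toEll u))).comp toEll)) u := by
  rw [show (energy b α p : HSpace a ha h hh → ℝ) = _ from funext (energy_eq α hp)]
  refine ((((hasFDerivAt_norm_sq u).const_mul (1 / 2)).add
    (((hasFDerivAt_gradL u).pow 2).const_mul (b / 4))).sub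
      ((hasFDerivAt_nonlocal α hp u).const_mul (1 / (2 * p)))).congr_fderiv ?_
  ext v
  have : p ≠ 0 := by linarith
  simp
  field_simp
  ring

theorem rieszForm_powEll_mulEll_self (u : HSpace a ha h hh) :
    rieszForm α (powEll hp (toEll u)) (mulEll (oddPowEll hp (toEll u)) (toEll u)) =
      nonlocal α hp u := by
  unfold nonlocal
  congr 1
  ext x
  exact oddPow_mul_self hp (u x)

/-- The functional `I(u) = (J'(u), u)`, whose zeros other than `0` form the Nehari manifold. -/
def nehariFun (b α : ℝ) {p : ℝ} (hp : 2 < p) (u : HSpace a ha h hh) : ℝ :=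
  ‖u‖ ^ 2 + b * gradL u u ^ 2 - nonlocal α hp u

theorem fderiv_energy_self (u : HSpace a ha h hh) :
    fderiv ℝ (energy b α p) u u = nehariFun b α hp u := by
  rw [(hasFDerivAt_energy α hp u).fderiv]
  simp only [_root_.add_apply, _root_.sub_apply, _root_.smul_apply,
    ContinuousLinearMap.comp_apply, rieszForm_powEll_mulEll_self,
    innerSL_apply_apply, real_inner_self_eq_norm_sq, smul_eq_mul, nehariFun]
  ring

theorem mem_nehari_iff (u : HSpace a ha h hh) :
    u ∈ nehari b α p ↔ u ≠ 0 ∧ nehariFun b α hp u = 0 := by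
  rw [← fderiv_energy_self]
  rfl

theorem contDiff_nehariFun : ContDiff ℝ 1 (nehariFun b α hp : HSpace a ha h hh → ℝ) :=
  ((contDiff_id.norm_sq ℝ).add (contDiff_const.mul (contDiff_gradL.pow 2))).sub
    (contDiff_nonlocal α hp)

/-- Euler's identity for terms of degrees `2`, `4`, `2p`. On the Nehari manifold it makes the radial
derivative negative, so the constraint is regular there. -/
theorem fderiv_nehariFun_self (u : HSpace a ha h hh) :
    fderiv ℝ (nehariFun b α hp) u u =
      2 * ‖u‖ ^ 2 + 4 * b * gradL u u ^ 2 - 2 * p * nonlocal α hp u := by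
  have h1 : HasFDerivAt (nehariFun b α hp : HSpace a ha h hh → ℝ) _ u :=
    (((hasFDerivAt_norm_sq u).add (((hasFDerivAt_gradL u).pow 2).const_mul b))).sub
      (hasFDerivAt_nonlocal α hp u)
  rw [h1.fderiv]
  simp [rieszForm_powEll_mulEll_self]
  ring

theorem nonlocal_smul (t : ℝ) (u : HSpace a ha h hh) :
    nonlocal α hp (t • u) = (|t| ^ p) ^ 2 * nonlocal α hp u := by
  have h1 : powEll hp (toEll (t • u)) = |t| ^ p • powEll hp (toEll u) := by
    ext x
    change |t * u x| ^ p = |t| ^ p * |u x| ^ p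
    rw [abs_mul, Real.mul_rpow (abs_nonneg _) (abs_nonneg _)]
  unfold nonlocal
  rw [h1]
  simp
  ring

end HSpace

/-! ### Pointwise null bounded sequences, Brezis–Lieb splitting, and compactness. -/

/-- If `|g n|` is bounded by an arbitrarily small multiple of a family `b n` with bounded sums, up
to a fixed summable function, then pointwise convergence `g n → 0` implies convergence in `ℓ¹`. -/
theorem tendsto_tsum_abs_zero {g b : ℕ → V → ℝ} {M : ℝ} (hb : ∀ n x, 0 ≤ b n x)
    (hbs : ∀ n, Summable (b n)) (hbM : ∀ n, ∑' x, b n x ≤ M)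
    (hg : ∀ x, Tendsto (fun n => g n x) atTop (𝓝 0))
    (hdom : ∀ η > 0, ∃ w : V → ℝ, Summable w ∧ ∀ n x, |g n x| ≤ η * b n x + w x) :
    Tendsto (fun n => ∑' x, |g n x|) atTop (𝓝 0) := by
  have hM : 0 ≤ M := (tsum_nonneg (hb 0)).trans (hbM 0)
  rw [Metric.tendsto_nhds]
  intro ε hε
  set η := ε / (2 * (M + 1)) with hη
  have hη0 : 0 < η := by positivity
  obtain ⟨w, hw, hgw⟩ := hdom η hη0
  -- The excess of `|g n|` over `η * b n` is dominated by the fixed summable `|w|`, so dominated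
  -- convergence applies to it; the remaining part sums to at most `η * M ≤ ε / 2`.
  set k : ℕ → V → ℝ := fun n x => max 0 (|g n x| - η * b n x) with hk
  have hkw : ∀ n x, |k n x| ≤ |w x| := fun n x => by
    rw [abs_of_nonneg (le_max_left _ _)]
    exact max_le (abs_nonneg _) (le_trans (by linarith [hgw n x]) (le_abs_self (w x)))
  have hks : ∀ n, Summable (k n) := fun n => Summable.of_norm_bounded hw.abs (hkw n)
  have hk0 : Tendsto (fun n => ∑' x, k n x) atTop (𝓝 0) := by
    have := tendsto_tsum_of_dominated_convergence (𝓕 := atTop) (f := k) (g := fun _ => 0) hw.abs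
      (fun x => ?_) (Eventually.of_forall hkw)
    · rwa [tsum_zero] at this
    · refine squeeze_zero (fun n => le_max_left _ _) (fun n => ?_) (by simpa using (hg x).abs)
      exact max_le (abs_nonneg _) (sub_le_self _ (mul_nonneg hη0.le (hb n x)))
  filter_upwards [(tendsto_order.1 hk0).2 (ε / 2) (by positivity)] with n hn
  have hs : Summable fun x => k n x + η * b n x := (hks n).add ((hbs n).mul_left η)
  have hle : ∀ x, |g n x| ≤ k n x + η * b n x := fun x => by
    linarith [le_max_right 0 (|g n x| - η * b n x)]
  have hgs : Summable fun x => |g n x| := Summable.of_nonneg_of_le (fun _ => abs_nonneg _) hle hs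
  rw [Real.dist_eq, sub_zero, abs_of_nonneg (tsum_nonneg fun _ => abs_nonneg _)]
  calc ∑' x, |g n x| ≤ ∑' x, (k n x + η * b n x) := hgs.tsum_le_tsum hle hs
    _ = ∑' x, k n x + η * ∑' x, b n x := by
        rw [(hks n).tsum_add ((hbs n).mul_left η), tsum_mul_left]
    _ ≤ ∑' x, k n x + η * M := by
        have := mul_le_mul_of_nonneg_left (hbM n) hη0.le
        linarith
    _ < ε := by
        have h1 : η * M ≤ ε / 2 := by
          rw [hη, div_mul_eq_mul_div, div_le_div_iff₀ (by positivity) (by positivity)]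
          nlinarith
        linarith

theorem abs_mul_le_inv_mul_sq_add_mul_sq {η : ℝ} (hη : 0 < η) (s t : ℝ) :
    |s * t| ≤ η⁻¹ * s ^ 2 + η * t ^ 2 := by
  have h1 : |s * t| = η * |(η⁻¹ * s) * t| := by
    rw [mul_assoc, abs_mul η⁻¹, abs_of_pos (inv_pos.2 hη), mul_inv_cancel_left₀ hη.ne']
  have h2 : |(η⁻¹ * s) * t| ≤ (η⁻¹ * s) ^ 2 + t ^ 2 := by
    rw [abs_le]
    constructor <;> nlinarith [sq_nonneg (η⁻¹ * s + t), sq_nonneg (η⁻¹ * s - t),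
      sq_nonneg (η⁻¹ * s), sq_nonneg t]
  rw [h1]
  refine (mul_le_mul_of_nonneg_left h2 hη.le).trans (le_of_eq ?_)
  field_simp

theorem abs_gradForm_le_inv_mul_add_mul {η : ℝ} (hη : 0 < η) (u v : V → ℝ) (x : V) :
    |gradForm u v x| ≤ η⁻¹ * gradForm u u x + η * gradForm v v x := by
  have h1 := abs_gradForm_le (η⁻¹ • u) v x
  rw [gradForm_smul_left, gradForm_smul_left, gradForm_comm u (η⁻¹ • u), gradForm_smul_left,
    abs_mul, abs_of_pos (inv_pos.2 hη)] at h1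
  have h2 := mul_le_mul_of_nonneg_left h1 hη.le
  rw [mul_inv_cancel_left₀ hη.ne', mul_add, mul_inv_cancel_left₀ hη.ne'] at h2
  exact h2

section Nonlocal

variable (α : ℝ) {p : ℝ} (hp : 2 < p)

theorem norm_powEll_le (u : Ell 2) : ‖powEll hp u‖ ≤ ‖u‖ ^ (p - 2) * ‖u‖ ^ 2 := by
  refine Ell.norm_le_of_abs_le_sq fun x => ?_
  rw [powEll_apply, abs_of_nonneg (Real.rpow_nonneg (abs_nonneg _) _)]
  exact abs_rpow_le hp (u.abs_apply_le x)

/-- Bounded pointwise null sequences in `ℓ¹` are null against `c₀`, though not against `ℓ^∞`; here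
`R_α ∗ f` is in `c₀` by `tendsto_conv_zero`. -/
theorem tendsto_rieszForm_zero {f : Ell 1} {g : ℕ → Ell 1} {K : ℝ} (hgK : ∀ n, ‖g n‖ ≤ K)
    (hg : ∀ x, Tendsto (fun n => g n x) atTop (𝓝 0)) :
    Tendsto (fun n => rieszForm α f (g n)) atTop (𝓝 0) := by
  obtain ⟨C, hC0, hC⟩ := exists_riesz_bound α
  have hK : 0 ≤ K := (norm_nonneg _).trans (hgK 0)
  have key := tendsto_tsum_abs_zero (g := fun n x => conv α f x * g n x) (b := fun n x => |g n x|)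
    (M := K) (fun n x => abs_nonneg _) (fun n => (g n).summable_abs)
    (fun n => by rw [← Ell.norm_eq_tsum]; exact hgK n)
    (fun x => by simpa using (hg x).const_mul (conv α f x)) fun η hη => ?_
  · refine squeeze_zero_norm (fun n => ?_) key
    rw [rieszForm_apply]
    refine tsum_of_norm_bounded (E := ℝ) (Summable.hasSum ?_) fun x => le_rfl
    refine Summable.of_nonneg_of_le (fun _ => abs_nonneg _) (fun x => ?_)
      ((g n).summable_abs.mul_left (C * ‖f‖))
    rw [abs_mul]
    exact mul_le_mul_of_nonneg_right (abs_conv_le α hC f x) (abs_nonneg _)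
  -- Off this finite set the convolution supplies the small factor; on it a constant is a summable
  -- bound.
  · have hfin : {x | ¬ |conv α f x| < η}.Finite := by
      have := (Metric.tendsto_nhds.1 (tendsto_conv_zero α f)) η hη
      simpa [Filter.eventually_cofinite] using this
    refine ⟨{x | ¬ |conv α f x| < η}.indicator fun _ => C * ‖f‖ * K,
      summable_of_hasFiniteSupport (hfin.subset Set.support_indicator_subset), fun n x => ?_⟩
    have hgx : |g n x| ≤ K := (lp.norm_apply_le_norm (by simp) (g n) x).trans (hgK n)
    rw [abs_mul]
    by_cases hx : |conv α f x| < η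
    · rw [Set.indicator_of_notMem (by simpa using hx), add_zero]
      exact mul_le_mul_of_nonneg_right hx.le (abs_nonneg _)
    · rw [Set.indicator_of_mem (by simpa using hx)]
      have h1 : |conv α f x| * |g n x| ≤ C * ‖f‖ * K :=
        mul_le_mul (abs_conv_le α hC f x) hgx (abs_nonneg _) (by positivity)
      have h2 : 0 ≤ η * |g n x| := by positivity
      linarith

/-- The splitting lemma of Brezis and Lieb for `u ↦ |u|^p`, in `ℓ¹`. -/
theorem tendsto_powEll_add_sub {u : Ell 2} {v : ℕ → Ell 2} {M : ℝ} (hvM : ∀ n, ‖v n‖ ≤ M)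
    (hv : ∀ x, Tendsto (fun n => v n x) atTop (𝓝 0)) :
    Tendsto (fun n => ‖powEll hp (u + v n) - powEll hp u - powEll hp (v n)‖) atTop (𝓝 0) := by
  have hM : 0 ≤ M := (norm_nonneg _).trans (hvM 0)
  simp only [Ell.norm_eq_tsum]
  refine tendsto_tsum_abs_zero (b := fun n x => v n x ^ 2) (M := M ^ 2) (fun _ _ => sq_nonneg _)
    (fun n => (v n).summable_sq) (fun n => ?_) (fun x => ?_) fun η hη => ?_
  · rw [← Ell.norm_sq_eq_tsum]
    exact pow_le_pow_left₀ (norm_nonneg _) (hvM n) 2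
  · change Tendsto (fun n => |u x + v n x| ^ p - |u x| ^ p - |v n x| ^ p) atTop (𝓝 0)
    have hc : Continuous fun t : ℝ => |u x + t| ^ p - |u x| ^ p - |t| ^ p := by
      have h1 : Continuous fun t : ℝ => |u x + t| ^ p :=
        (continuous_const.add continuous_id).abs.rpow_const fun _ => Or.inr (by linarith)
      have h2 : Continuous fun t : ℝ => |t| ^ p :=
        continuous_abs.rpow_const fun _ => Or.inr (by linarith)
      exact (h1.sub continuous_const).sub h2
    have := (hc.tendsto 0).comp (hv x)
    simpa [Function.comp_def, Real.zero_rpow (show p ≠ 0 by linarith)] using this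
  · obtain ⟨C, _, hC⟩ := exists_abs_rpow_add_sub_le hp
      (show 0 ≤ ‖u‖ + M by positivity) hη
    refine ⟨fun x => C * u x ^ 2, u.summable_sq.mul_left C, fun n x => ?_⟩
    have h1 : |u x| ≤ ‖u‖ := u.abs_apply_le x
    have h2 : |v n x| ≤ M := ((v n).abs_apply_le x).trans (hvM n)
    exact hC (u x) (v n x) (h1.trans (by linarith)) (h2.trans (by linarith [norm_nonneg u]))
      ((abs_add_le _ _).trans (add_le_add h1 h2))

/-- With `|u + v_n|^p = f + g_n + ρ_n`, the difference is `2 B(f, g_n)` plus terms containing `ρ_n`.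
The first vanishes by `tendsto_rieszForm_zero`, the others because `ρ_n → 0` in `ℓ¹` by the scalar
Brezis–Lieb lemma. -/
theorem tendsto_rieszForm_powEll_add_sub {u : Ell 2} {v : ℕ → Ell 2} {M : ℝ}
    (hvM : ∀ n, ‖v n‖ ≤ M) (hv : ∀ x, Tendsto (fun n => v n x) atTop (𝓝 0)) :
    Tendsto (fun n => rieszForm α (powEll hp (u + v n)) (powEll hp (u + v n)) -
      rieszForm α (powEll hp u) (powEll hp u) -
      rieszForm α (powEll hp (v n)) (powEll hp (v n))) atTop (𝓝 0) := by
  have hM : 0 ≤ M := (norm_nonneg _).trans (hvM 0)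
  set f := powEll hp u with hf
  set g : ℕ → Ell 1 := fun n => powEll hp (v n) with hg
  set ρ : ℕ → Ell 1 := fun n => powEll hp (u + v n) - f - g n with hρ
  set K := M ^ (p - 2) * M ^ 2 with hK
  have hgK : ∀ n, ‖g n‖ ≤ K := fun n => by
    refine (norm_powEll_le hp (v n)).trans ?_
    exact mul_le_mul (Real.rpow_le_rpow (norm_nonneg _) (hvM n) (by linarith))
      (pow_le_pow_left₀ (norm_nonneg _) (hvM n) 2) (by positivity) (by positivity)
  have hg0 : ∀ x, Tendsto (fun n => g n x) atTop (𝓝 0) := fun x => by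
    have h2 : Continuous fun t : ℝ => |t| ^ p :=
      continuous_abs.rpow_const fun _ => Or.inr (by linarith)
    have := (h2.tendsto 0).comp (hv x)
    rw [abs_zero, Real.zero_rpow (by linarith)] at this
    exact this
  have hρ0 : Tendsto (fun n => ‖ρ n‖) atTop (𝓝 0) := tendsto_powEll_add_sub hp hvM hv
  have hfg := tendsto_rieszForm_zero α (f := f) hgK hg0
  have hlim : Tendsto (fun n => 2 * |rieszForm α f (g n)| +
      ‖rieszForm α‖ * (2 * (‖f‖ + K) + ‖ρ n‖) * ‖ρ n‖) atTop (𝓝 0) := by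
    have h1 := (hfg.abs.const_mul 2).add
      (((tendsto_const_nhds (x := 2 * (‖f‖ + K))).add hρ0).const_mul ‖rieszForm α‖ |>.mul hρ0)
    simpa using h1
  refine squeeze_zero_norm (fun n => ?_) hlim
  have e1 : powEll hp (u + v n) = f + g n + ρ n := by simp only [hρ]; abel
  have e2 : rieszForm α (powEll hp (u + v n)) (powEll hp (u + v n)) - rieszForm α f f -
      rieszForm α (g n) (g n) =
      2 * rieszForm α f (g n) + (2 * rieszForm α (f + g n) (ρ n) + rieszForm α (ρ n) (ρ n)) := by
    rw [e1]
    simp only [map_add, _root_.add_apply]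
    rw [rieszForm_comm α (g n) f, rieszForm_comm α (ρ n) f, rieszForm_comm α (ρ n) (g n)]
    ring
  rw [e2, Real.norm_eq_abs]
  refine (abs_add_le _ _).trans (add_le_add ?_ ?_)
  · rw [abs_mul, abs_two]
  · have b1 : |rieszForm α (f + g n) (ρ n)| ≤ ‖rieszForm α‖ * (‖f‖ + K) * ‖ρ n‖ := by
      refine ((rieszForm α).le_opNorm₂ _ _).trans ?_
      have : ‖f + g n‖ ≤ ‖f‖ + K := (norm_add_le _ _).trans (by linarith [hgK n])
      gcongr
    have b2 : |rieszForm α (ρ n) (ρ n)| ≤ ‖rieszForm α‖ * ‖ρ n‖ * ‖ρ n‖ :=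
      (rieszForm α).le_opNorm₂ _ _
    refine (abs_add_le _ _).trans ?_
    rw [abs_mul, abs_two]
    linarith

end Nonlocal

section HSpace

variable {a : ℝ} {ha : 0 < a} {h : V → ℝ} {hh : PosBelow h}

open KirchhoffChoquard.HSpace

/-- Weak convergence in concrete form: weighted Young inequalities bound the cross terms by `η`
times the density of `v n` plus a fixed summable density of `u`, as `tendsto_tsum_abs_zero`
requires. -/
theorem tendsto_inner_zero {u : HSpace a ha h hh} {v : ℕ → HSpace a ha h hh} {M : ℝ}
    (hvM : ∀ n, ‖v n‖ ≤ M) (hv : ∀ x, Tendsto (fun n => v n x) atTop (𝓝 0)) :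
    Tendsto (fun n => inner ℝ u (v n)) atTop (𝓝 0) ∧
      Tendsto (fun n => gradL u (v n)) atTop (𝓝 0) := by
  have hM : ∀ n, ‖v n‖ ^ 2 ≤ M ^ 2 := fun n => pow_le_pow_left₀ (norm_nonneg _) (hvM n) 2
  have hgrad : ∀ x, Tendsto (fun n => gradForm u (v n) x) atTop (𝓝 0) := fun x => by
    have : Tendsto (fun n => gradForm u (v n) x) atTop
        (𝓝 (1 / 2 * ∑ y ∈ nbrs x, (u y - u x) * (0 - 0))) :=
      (tendsto_finsetSum _ fun y _ => ((hv y).sub (hv x)).const_mul _).const_mul _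
    simpa using this
  have hgs : ∀ n, Summable (gradForm (v n) (v n)) := fun n =>
    summable_gradForm_self (v n).summable_sq
  constructor
  · refine squeeze_zero_norm (fun n => ?_) (tendsto_tsum_abs_zero
      (g := fun n x => a * gradForm u (v n) x + h x * (u x * v n x))
      (b := fun n x => a * gradForm (v n) (v n) x + h x * v n x ^ 2) (M := M ^ 2)
      (fun n x => ?_) (fun n => ((hgs n).mul_left a).add (v n).2.2) (fun n => ?_) (fun x => ?_)
      fun η hη => ?_)
    · rw [inner_eq_tsum]
      exact tsum_of_norm_bounded (E := ℝ) (u.summable_form (v n)).abs.hasSum fun x => le_rfl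
    · exact add_nonneg (mul_nonneg ha.le (gradForm_self_nonneg _ _))
        (mul_nonneg (hh.nonneg x) (sq_nonneg _))
    · rw [← norm_sq_eq_tsum]
      exact hM n
    · have := ((hgrad x).const_mul a).add (((hv x).const_mul (u x)).const_mul (h x))
      simpa using this
    · refine ⟨fun x => η⁻¹ * (a * gradForm u u x + h x * u x ^ 2),
        (((summable_gradForm_self u.summable_sq).mul_left a).add u.2.2).mul_left _, fun n x => ?_⟩
      have h1 := mul_le_mul_of_nonneg_left (abs_gradForm_le_inv_mul_add_mul hη u (v n) x) ha.le
      have h2 := mul_le_mul_of_nonneg_left (abs_mul_le_inv_mul_sq_add_mul_sq hη (u x) (v n x))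
        (hh.nonneg x)
      refine (abs_add_le _ _).trans ?_
      rw [abs_mul, abs_mul (h x), abs_of_pos ha, abs_of_nonneg (hh.nonneg x)]
      linarith
  · refine squeeze_zero_norm (fun n => ?_) (tendsto_tsum_abs_zero
      (g := fun n x => gradForm u (v n) x)
      (b := fun n x => gradForm (v n) (v n) x) (M := a⁻¹ * M ^ 2)
      (fun n x => gradForm_self_nonneg _ _) hgs (fun n => ?_) hgrad fun η hη => ?_)
    · rw [gradL_apply]
      exact tsum_of_norm_bounded (E := ℝ)
        (summable_gradForm u.summable_sq (v n).summable_sq).abs.hasSum fun x => le_rfl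
    · exact (v n).tsum_gradForm_le.trans
        (mul_le_mul_of_nonneg_left (hM n) (inv_nonneg.2 ha.le))
    · refine ⟨fun x => η⁻¹ * gradForm u u x,
        (summable_gradForm_self u.summable_sq).mul_left _, fun n x => ?_⟩
      linarith [abs_gradForm_le_inv_mul_add_mul hη u (v n) x]

theorem HSpace.abs_apply_le (u : HSpace a ha h hh) (x : V) :
    |u x| ≤ ‖(toEll : HSpace a ha h hh →L[ℝ] Ell 2)‖ * ‖u‖ :=
  ((toEll u).abs_apply_le x).trans (toEll.le_opNorm u)

/-- Bounded sequences in `H` have pointwise convergent subsequences with limit in `H`. -/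
theorem exists_subseq_tendsto_pointwise {u : ℕ → HSpace a ha h hh} {M : ℝ}
    (huM : ∀ n, ‖u n‖ ≤ M) :
    ∃ (w : HSpace a ha h hh) (φ : ℕ → ℕ), StrictMono φ ∧
      ∀ x, Tendsto (fun n => u (φ n) x) atTop (𝓝 (w x)) := by
  set K := ‖(toEll : HSpace a ha h hh →L[ℝ] Ell 2)‖ * M with hK
  have hbd : ∀ n x, |u n x| ≤ K := fun n x =>
    ((u n).abs_apply_le x).trans
      (mul_le_mul_of_nonneg_left (huM n) (ContinuousLinearMap.opNorm_nonneg _))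
  -- Coordinates are uniformly bounded, so Tychonoff over a countable index set replaces weak
  -- compactness.
  have hc : IsCompact (Set.univ.pi fun _ : V => Set.Icc (-K) K) :=
    isCompact_univ_pi fun _ => isCompact_Icc
  obtain ⟨w, _, φ, hφ, hlim⟩ := hc.isSeqCompact (x := fun n => (u n : V → ℝ))
    (fun n x _ => abs_le.1 (hbd n x))
  have hpt : ∀ x, Tendsto (fun n => u (φ n) x) atTop (𝓝 (w x)) :=
    tendsto_pi_nhds.1 hlim
  -- Fatou by hand: finite partial sums pass to the limit under the bound `M ^ 2`.
  have hsum : Summable fun x => h x * w x ^ 2 := by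
    refine summable_of_sum_le (c := M ^ 2) (fun x => mul_nonneg (hh.nonneg x) (sq_nonneg _))
      fun s => ?_
    have ht : Tendsto (fun n => ∑ x ∈ s, h x * u (φ n) x ^ 2) atTop
        (𝓝 (∑ x ∈ s, h x * w x ^ 2)) :=
      tendsto_finsetSum _ fun x _ => ((hpt x).pow 2).const_mul _
    refine le_of_tendsto' ht fun n => ?_
    calc ∑ x ∈ s, h x * u (φ n) x ^ 2 ≤ ∑' x, h x * u (φ n) x ^ 2 :=
          (u (φ n)).2.2.sum_le_tsum s fun x _ => mul_nonneg (hh.nonneg x) (sq_nonneg _)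
      _ ≤ ‖u (φ n)‖ ^ 2 := (u (φ n)).tsum_weighted_le
      _ ≤ M ^ 2 := pow_le_pow_left₀ (norm_nonneg _) (huM _) 2
  have hsq : Summable fun x => w x ^ 2 := by
    obtain ⟨h₀, h₀pos, hle⟩ := hh
    refine Summable.of_nonneg_of_le (fun x => sq_nonneg _) (fun x => ?_) (hsum.mul_left h₀⁻¹)
    rw [le_inv_mul_iff₀ h₀pos]
    exact mul_le_mul_of_nonneg_right (hle x) (sq_nonneg _)
  exact ⟨⟨w, memH1_iff.2 hsq, hsum⟩, φ, hφ, hpt⟩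

end HSpace

section HSpace

variable {a : ℝ} {ha : 0 < a} {h : V → ℝ} {hh : PosBelow h}

open KirchhoffChoquard.HSpace

/-! ### Geometry of the Nehari manifold. -/

section Nehari

variable {b p : ℝ} (α : ℝ)

/-- The expression `(1/2 - 1/(2p)) ‖u‖² + (1/4 - 1/(2p)) b (∑ |∇u|²)²`, which agrees with the energy
on the Nehari manifold. -/
def reducedEnergy (b p : ℝ) (u : HSpace a ha h hh) : ℝ :=
  (1 / 2 - 1 / (2 * p)) * ‖u‖ ^ 2 + (1 / 4 - 1 / (2 * p)) * b * gradL u u ^ 2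

/-- Subtracting `1/(2p)` times the constraint eliminates the nonlocal term. -/
theorem energy_eq_reducedEnergy (hp : 2 < p) {u : HSpace a ha h hh} (hu : nehariFun b α hp u = 0) :
    energy b α p u = reducedEnergy b p u := by
  rw [energy_eq α hp, reducedEnergy]
  unfold nehariFun at hu
  linear_combination (-(1 / (2 * p))) * (-hu)

theorem half_sub_pos (hp : 2 < p) : 0 < 1 / 2 - 1 / (2 * p) ∧ 0 < 1 / 4 - 1 / (2 * p) := by
  have h1 : 1 / (2 * p) < 1 / 4 := by
    rw [div_lt_div_iff₀ (by linarith) (by norm_num)]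
    linarith
  constructor <;> linarith

theorem mul_norm_sq_le_reducedEnergy (hp : 2 < p) (hb : 0 < b) (u : HSpace a ha h hh) :
    (1 / 2 - 1 / (2 * p)) * ‖u‖ ^ 2 ≤ reducedEnergy b p u :=
  le_add_of_nonneg_right (by have := (half_sub_pos hp).2; positivity)

theorem reducedEnergy_nonneg (hp : 2 < p) (hb : 0 < b) (u : HSpace a ha h hh) :
    0 ≤ reducedEnergy b p u :=
  le_trans (by have := (half_sub_pos hp).1; positivity) (mul_norm_sq_le_reducedEnergy hp hb u)

theorem gradL_smul_smul (t : ℝ) (u : HSpace a ha h hh) :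
    gradL (t • u) (t • u) = t ^ 2 * gradL u u := by
  simp
  ring

theorem reducedEnergy_smul_le (hp : 2 < p) (hb : 0 < b) {t : ℝ} (ht : 0 ≤ t) (ht1 : t ≤ 1)
    (u : HSpace a ha h hh) : reducedEnergy b p (t • u) ≤ reducedEnergy b p u := by
  unfold reducedEnergy
  obtain ⟨h1, h2⟩ := half_sub_pos hp
  have h3 : ‖t • u‖ ≤ ‖u‖ := by
    rw [norm_smul, Real.norm_of_nonneg ht]
    exact mul_le_of_le_one_left (norm_nonneg _) ht1
  have h4 : gradL (t • u) (t • u) ≤ gradL u u := by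
    rw [gradL_smul_smul]
    exact mul_le_of_le_one_left (gradL_self_nonneg u) (pow_le_one₀ ht ht1)
  have h5 := gradL_self_nonneg (t • u)
  gcongr

/-- If `(J'(u), u) ≤ 0` then a multiple `t u` with `0 < t ≤ 1` lies on the Nehari manifold. -/
theorem exists_smul_nehariFun_eq_zero (hp : 2 < p) (hb : 0 < b) {u : HSpace a ha h hh} (hu : u ≠ 0)
    (hI : nehariFun b α hp u ≤ 0) :
    ∃ t : ℝ, 0 < t ∧ t ≤ 1 ∧ nehariFun b α hp (t • u) = 0 := by
  have hn : 0 < ‖u‖ ^ 2 := by have := norm_pos_iff.2 hu; positivity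
  have hD : ‖u‖ ^ 2 ≤ nonlocal α hp u := by
    have : 0 ≤ b * gradL u u ^ 2 := by positivity
    unfold nehariFun at hI
    linarith
  have hDpos := hn.trans_le hD
  set r := ‖u‖ ^ 2 / nonlocal α hp u with hr
  have hr0 : 0 < r := div_pos hn hDpos
  have hr1 : r ≤ 1 := (div_le_one hDpos).2 hD
  -- This `s` solves `s² N = s^{2p} D`, the constraint without the Kirchhoff term. At `s • u` only
  -- `b G² ≥ 0` remains, so the intermediate value theorem applies on `[s, 1]`.
  set s := r ^ (1 / (2 * p - 2)) with hs
  have hs0 : 0 < s := Real.rpow_pos_of_pos hr0 _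
  have hs1 : s ≤ 1 := Real.rpow_le_one hr0.le hr1 (by
    have : 0 < 2 * p - 2 := by linarith
    positivity)
  have hsp : (s ^ p) ^ 2 = s ^ 2 * r := by
    have h1 : (s ^ p) ^ 2 = s ^ (2 + (2 * p - 2)) := by
      rw [← Real.rpow_natCast, ← Real.rpow_mul hs0.le]
      congr 1
      push_cast
      ring
    rw [h1, Real.rpow_add hs0, Real.rpow_two]
    congr 1
    rw [hs, ← Real.rpow_mul hr0.le, one_div_mul_cancel (by linarith), Real.rpow_one]
  have hIs : 0 ≤ nehariFun b α hp (s • u) := by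
    unfold nehariFun
    rw [nonlocal_smul, abs_of_pos hs0, hsp, mul_assoc, hr, div_mul_cancel₀ _ hDpos.ne', norm_smul,
      mul_pow, Real.norm_of_nonneg hs0.le]
    have : 0 ≤ b * gradL (s • u) (s • u) ^ 2 := by positivity
    linarith
  have hcont : Continuous fun t : ℝ => nehariFun b α hp (t • u) :=
    (contDiff_nehariFun α hp).continuous.comp (continuous_id.smul continuous_const)
  obtain ⟨t, ht, ht0⟩ := intermediate_value_Icc' hs1 hcont.continuousOn
    (show (0 : ℝ) ∈ Set.Icc (nehariFun b α hp ((1 : ℝ) • u)) (nehariFun b α hp (s • u)) by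
      rw [one_smul]
      exact ⟨hI, hIs⟩)
  exact ⟨t, hs0.trans_le ht.1, ht.2, ht0⟩

theorem smul_mem_nehari (hp : 2 < p) {u : HSpace a ha h hh} (hu : u ≠ 0) {t : ℝ} (ht : 0 < t)
    (hI : nehariFun b α hp (t • u) = 0) : t • u ∈ nehari b α p :=
  (mem_nehari_iff α hp _).2 ⟨smul_ne_zero ht.ne' hu, hI⟩

/-- The function `δ_x`, as an element of `H`. -/
def delta (x : V) : HSpace a ha h hh :=
  ⟨Pi.single x 1, memH1_iff.2 (summable_of_hasFiniteSupport ((Set.finite_singleton x).subset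
    fun y hy => by
      by_contra hne
      exact hy (by simp [Pi.single_eq_of_ne hne]))),
    summable_of_hasFiniteSupport ((Set.finite_singleton x).subset fun y hy => by
      by_contra hne
      exact hy (by simp [Pi.single_eq_of_ne hne]))⟩

theorem delta_apply (x y : V) : (delta x : HSpace a ha h hh) y = if y = x then 1 else 0 := by
  change (Pi.single x 1 : V → ℝ) y = _
  rw [Pi.single_apply]

theorem delta_ne_zero (x : V) : (delta x : HSpace a ha h hh) ≠ 0 := fun hx => by
  have h1 := delta_apply (ha := ha) (hh := hh) x x
  rw [hx, zero_apply, if_pos rfl] at h1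
  exact zero_ne_one h1

theorem nonlocal_delta (hp : 2 < p) (x : V) :
    nonlocal α hp (delta x : HSpace a ha h hh) = riesz α x x := by
  have h1 : ∀ y, powEll hp (toEll (delta x : HSpace a ha h hh)) y = if y = x then 1 else 0 := by
    intro y
    rw [powEll_apply, toEll_apply, delta_apply]
    split_ifs
    · simp
    · rw [abs_zero, Real.zero_rpow (by linarith)]
  unfold nonlocal
  rw [rieszForm_apply]
  simp only [conv, h1, mul_ite, mul_one, mul_zero, tsum_ite_eq]

theorem nonempty_nehari (hp : 2 < p) (hb : 0 < b) (hα : 0 < α) (hα' : α < 3) :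
    (nehari b α p : Set (HSpace a ha h hh)).Nonempty := by
  set u : HSpace a ha h hh := delta 0
  have hD : 0 < nonlocal α hp u := by
    rw [nonlocal_delta]
    exact riesz_self_pos hα hα' 0
  set A := ‖u‖ ^ 2 + b * gradL u u ^ 2 with hA
  have hA0 : 0 ≤ A := by positivity
  -- Chosen so that `t ≥ 1` satisfies `t^{2p} D = t⁴ (D + A)`, which exceeds `t² N + t⁴ b G² ≤ t⁴
  -- A`.
  set r := 1 + A / nonlocal α hp u with hr
  have hr1 : 1 ≤ r := le_add_of_nonneg_right (by positivity)
  have he : 0 < 2 * p - 4 := by linarith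
  set t := r ^ (1 / (2 * p - 4)) with ht
  have ht1 : 1 ≤ t := Real.one_le_rpow hr1 (by positivity)
  have ht0 : 0 < t := by linarith
  have htp : (t ^ p) ^ 2 = t ^ 4 * r := by
    have h1 : (t ^ p) ^ 2 = t ^ (((4 : ℕ) : ℝ) + (2 * p - 4)) := by
      rw [← Real.rpow_natCast, ← Real.rpow_mul ht0.le]
      congr 1
      push_cast
      ring
    rw [h1, Real.rpow_add ht0, Real.rpow_natCast]
    congr 1
    rw [ht, ← Real.rpow_mul (by linarith), one_div_mul_cancel he.ne', Real.rpow_one]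
  have hI : nehariFun b α hp (t • u) ≤ 0 := by
    unfold nehariFun
    rw [nonlocal_smul, abs_of_pos ht0, htp, gradL_smul_smul, norm_smul,
      Real.norm_of_nonneg ht0.le]
    have h1 : r * nonlocal α hp u = nonlocal α hp u + A := by
      rw [hr, add_mul, one_mul, div_mul_cancel₀ _ hD.ne']
    have h2 : t ^ 2 ≤ t ^ 4 := pow_le_pow_right₀ ht1 (by norm_num)
    have h3 : (t * ‖u‖) ^ 2 ≤ t ^ 4 * ‖u‖ ^ 2 := by
      rw [mul_pow]
      exact mul_le_mul_of_nonneg_right h2 (by positivity)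
    rw [mul_assoc, h1, hA]
    have h4 : 0 ≤ t ^ 4 * nonlocal α hp u := by positivity
    have h5 : b * (t ^ 2 * gradL u u) ^ 2 = t ^ 4 * (b * gradL u u ^ 2) := by ring
    rw [h5]
    linarith
  have hu : t • u ≠ 0 := smul_ne_zero ht0.ne' (delta_ne_zero 0)
  obtain ⟨s, hs, _, hs0⟩ := exists_smul_nehariFun_eq_zero α hp hb hu hI
  exact ⟨_, smul_mem_nehari α hp hu hs hs0⟩

/-- On bounded subsets of the Nehari manifold the supremum norm is bounded below. -/
theorem exists_le_abs_apply_of_mem_nehari (hp : 2 < p) (hb : 0 < b) (M : ℝ) :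
    ∃ δ > 0, ∀ u : HSpace a ha h hh, u ∈ nehari b α p → ‖u‖ ≤ M → ∃ x, δ ≤ |u x| := by
  set T := ‖(toEll : HSpace a ha h hh →L[ℝ] Ell 2)‖ with hT
  have hT0 : 0 ≤ T := ContinuousLinearMap.opNorm_nonneg _
  have hB0 : 0 ≤ ‖rieszForm α‖ := ContinuousLinearMap.opNorm_nonneg _
  set Q := ‖rieszForm α‖ * T ^ 4 * M ^ 2 with hQ
  have hQ0 : 0 ≤ Q := by positivity
  -- If `|u|^{p-2} ≤ r` everywhere, then `D ≤ r² Q N`, whereas the constraint forces `N ≤ D`. This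
  -- `r` makes `r² Q < 1`.
  set r := 1 / (1 + Q) with hr
  have hr0 : 0 < r := by positivity
  refine ⟨r ^ (1 / (p - 2)), Real.rpow_pos_of_pos hr0 _, fun u hu huM => ?_⟩
  by_contra! hlt
  obtain ⟨hu0, hI⟩ := (mem_nehari_iff α hp u).1 hu
  have hn : 0 < ‖u‖ ^ 2 := by have := norm_pos_iff.2 hu0; positivity
  have hpow : ‖powEll hp (toEll u)‖ ≤ r * (T * ‖u‖) ^ 2 := by
    have h1 : ‖powEll hp (toEll u)‖ ≤ r * ‖toEll u‖ ^ 2 := by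
      refine Ell.norm_le_of_abs_le_sq fun x => ?_
      rw [powEll_apply, abs_of_nonneg (Real.rpow_nonneg (abs_nonneg _) _)]
      refine (abs_rpow_le hp (hlt x).le).trans (le_of_eq ?_)
      rw [← Real.rpow_mul hr0.le, one_div_mul_cancel (by linarith), Real.rpow_one]
      rfl
    refine h1.trans (mul_le_mul_of_nonneg_left ?_ hr0.le)
    exact pow_le_pow_left₀ (norm_nonneg _) (toEll.le_opNorm u) 2
  have hD : nonlocal α hp u ≤ ‖rieszForm α‖ * (r * (T * ‖u‖) ^ 2) * (r * (T * ‖u‖) ^ 2) := by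
    refine (le_abs_self _).trans (((rieszForm α).le_opNorm₂ _ _).trans ?_)
    gcongr
  have hle : ‖u‖ ^ 2 ≤ nonlocal α hp u := by
    have : 0 ≤ b * gradL u u ^ 2 := by positivity
    unfold nehariFun at hI
    linarith
  have h2 : ‖u‖ ^ 2 * 1 ≤ ‖u‖ ^ 2 * (r ^ 2 * Q) := by
    have h3 : ‖u‖ ^ 2 ≤ M ^ 2 := pow_le_pow_left₀ (norm_nonneg _) huM 2
    calc ‖u‖ ^ 2 * 1 ≤ ‖rieszForm α‖ * (r * (T * ‖u‖) ^ 2) * (r * (T * ‖u‖) ^ 2) := by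
          rw [mul_one]
          exact hle.trans hD
      _ = ‖u‖ ^ 2 * (r ^ 2 * (‖rieszForm α‖ * T ^ 4 * ‖u‖ ^ 2)) := by ring
      _ ≤ ‖u‖ ^ 2 * (r ^ 2 * (‖rieszForm α‖ * T ^ 4 * M ^ 2)) := by gcongr
  have h4 : 1 ≤ r ^ 2 * Q := le_of_mul_le_mul_left h2 hn
  have h5 : r * (1 + Q) = 1 := by rw [hr]; field_simp
  nlinarith

/-- Minimisers of the energy on the Nehari manifold are critical points. -/
theorem hasFDerivAt_energy_zero_of_isMinOn (hp : 2 < p) (hb : 0 < b) {u : HSpace a ha h hh}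
    (hu : u ∈ nehari b α p) (hmin : ∀ w ∈ (nehari b α p : Set (HSpace a ha h hh)),
      energy b α p u ≤ energy b α p w) :
    HasFDerivAt (energy b α p) (0 : HSpace a ha h hh →L[ℝ] ℝ) u := by
  obtain ⟨hu0, hI⟩ := (mem_nehari_iff α hp u).1 hu
  have hn : 0 < ‖u‖ ^ 2 := by have := norm_pos_iff.2 hu0; positivity
  have hJd : HasFDerivAt (energy b α p) (fderiv ℝ (energy b α p) u) u :=
    (((contDiff_energy α hp).differentiable one_ne_zero) u).hasFDerivAt
  suffices hz : fderiv ℝ (energy b α p) u = 0 by rwa [hz] at hJd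
  ext v
  -- Restricting to the span of `u` and the test direction `v` puts the multiplier theorem on `ℝ ×
  -- ℝ`, so completeness of `H` plays no role.
  set L : ℝ × ℝ →L[ℝ] HSpace a ha h hh :=
    (ContinuousLinearMap.fst ℝ ℝ ℝ).smulRight u + (ContinuousLinearMap.snd ℝ ℝ ℝ).smulRight v
    with hL
  have hL1 : L (1, 0) = u := by simp [hL]
  have hL2 : L (0, 1) = v := by simp [hL]
  have hsJ : HasStrictFDerivAt (fun z => energy b α p (L z))
      ((fderiv ℝ (energy b α p) u).comp L) (1, 0) := by
    have h1 := (contDiff_energy (a := a) (ha := ha) (hh := hh) (b := b) α hp).contDiffAt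
      (x := L (1, 0)) |>.hasStrictFDerivAt one_ne_zero
    have h2 := h1.comp _ L.hasStrictFDerivAt
    rwa [hL1] at h2
  have hsI : HasStrictFDerivAt (fun z => nehariFun b α hp (L z))
      ((fderiv ℝ (nehariFun b α hp) u).comp L) (1, 0) := by
    have h1 := (contDiff_nehariFun (a := a) (ha := ha) (hh := hh) (b := b) α hp).contDiffAt
      (x := L (1, 0)) |>.hasStrictFDerivAt one_ne_zero
    have h2 := h1.comp _ L.hasStrictFDerivAt
    rwa [hL1] at h2
  have hext : IsLocalExtrOn (fun z => energy b α p (L z))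
      {z | nehariFun b α hp (L z) = nehariFun b α hp (L (1, 0))} (1, 0) := by
    refine Or.inl ?_
    have hne : ∀ᶠ z in 𝓝 ((1 : ℝ), (0 : ℝ)), L z ≠ 0 := by
      refine L.continuous.continuousAt.eventually_ne ?_
      rwa [hL1]
    filter_upwards [hne.filter_mono nhdsWithin_le_nhds, self_mem_nhdsWithin] with z hz hzI
    have hzI : nehariFun b α hp (L z) = nehariFun b α hp (L (1, 0)) := hzI
    rw [hL1, hI] at hzI
    simp only [hL1]
    exact hmin _ ((mem_nehari_iff α hp _).2 ⟨hz, hzI⟩)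
  obtain ⟨c, d, hcd, hsum⟩ := hext.exists_multipliers_of_hasStrictFDerivAt_1d hsI hsJ
  have e1 := congrArg (fun w : ℝ × ℝ →L[ℝ] ℝ => w (1, 0)) hsum
  have e2 := congrArg (fun w : ℝ × ℝ →L[ℝ] ℝ => w (0, 1)) hsum
  simp only [_root_.add_apply, _root_.smul_apply, ContinuousLinearMap.comp_apply, hL1, hL2,
    smul_eq_mul, _root_.zero_apply, fderiv_energy_self α hp, hI, mul_zero, add_zero] at e1 e2
  -- In the direction `u` the multiplier relation reads `c I'(u)u = 0`, since `J'(u)u = 0`; and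
  -- `I'(u)u = (2 - 2p) N + (4 - 2p) b G² < 0`.
  have hc : c = 0 := by
    refine (mul_eq_zero.1 e1).resolve_right (ne_of_lt ?_)
    rw [fderiv_nehariFun_self]
    unfold nehariFun at hI
    have h3 : 0 ≤ b * gradL u u ^ 2 := by positivity
    have h4 : nonlocal α hp u = ‖u‖ ^ 2 + b * gradL u u ^ 2 := by linarith
    rw [h4]
    nlinarith
  have hd : d ≠ 0 := fun hd => hcd (by rw [hc, hd]; rfl)
  rw [hc, zero_mul, zero_add] at e2
  exact (mul_eq_zero.1 e2).resolve_left hd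

end Nehari

end HSpace

/-! ### Invariance under translations by the period lattice. -/

section HSpace

variable {a : ℝ} {ha : 0 < a} {h : V → ℝ} {hh : PosBelow h}

open KirchhoffChoquard.HSpace

theorem gradForm_translate (u v : V → ℝ) (w x : V) :
    gradForm (fun y => u (y + w)) (fun y => v (y + w)) x = gradForm u v (x + w) := by
  unfold gradForm
  rw [sum_nbrs (fun y => (u (y + w) - u (x + w)) * (v (y + w) - v (x + w))),
    sum_nbrs (fun y => (u y - u (x + w)) * (v y - v (x + w)))]
  simp only [add_right_comm x _ w]

/-- The translate `u(· + τ z)` of `u ∈ H`, for a `τ`-periodic potential. -/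
def translate {τ : ℤ} (hper : IsPeriodic τ h) (z : V) (u : HSpace a ha h hh) : HSpace a ha h hh :=
  ⟨fun x => u (x + τ • z),
    memH1_iff.2 ((Equiv.addRight (τ • z)).summable_iff (f := fun x => u x ^ 2) |>.2 u.summable_sq),
    ((Equiv.addRight (τ • z)).summable_iff (f := fun x => h x * u x ^ 2) |>.2 u.2.2).congr
      fun x => by
        simp only [Function.comp_apply, Equiv.coe_addRight]
        rw [hper x z]⟩

section Translate

variable {τ : ℤ} (hper : IsPeriodic τ h) (z : V) (u : HSpace a ha h hh)

theorem translate_apply (x : V) : translate hper z u x = u (x + τ • z) := rfl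

theorem gradL_translate : gradL (translate hper z u) (translate hper z u) = gradL u u := by
  rw [gradL_apply, gradL_apply, ← (Equiv.addRight (τ • z)).tsum_eq (gradForm u u)]
  exact tsum_congr fun x => gradForm_translate _ _ _ _

theorem norm_translate : ‖translate hper z u‖ = ‖u‖ := by
  rw [← sq_eq_sq₀ (norm_nonneg _) (norm_nonneg _), norm_sq_eq_tsum, norm_sq_eq_tsum,
    ← (Equiv.addRight (τ • z)).tsum_eq fun x => a * gradForm u u x + h x * u x ^ 2]
  refine tsum_congr fun x => ?_
  rw [Equiv.coe_addRight, hper x z, ← gradForm_translate]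
  rfl

theorem conv_translate (α : ℝ) (f : V → ℝ) (w x : V) :
    conv α (fun y => f (y + w)) x = conv α f (x + w) := by
  unfold conv
  rw [← (Equiv.addRight w).tsum_eq fun y => riesz α (x + w) y * f y]
  refine tsum_congr fun y => ?_
  rw [Equiv.coe_addRight, riesz_add_right]

theorem nonlocal_translate (α : ℝ) {p : ℝ} (hp : 2 < p) :
    nonlocal α hp (translate hper z u) = nonlocal α hp u := by
  change ∑' x, conv α (fun y => |u (y + τ • z)| ^ p) x * |u (x + τ • z)| ^ p =
    ∑' x, conv α (fun y => |u y| ^ p) x * |u x| ^ p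
  rw [← (Equiv.addRight (τ • z)).tsum_eq fun x => conv α (fun y => |u y| ^ p) x * |u x| ^ p]
  refine tsum_congr fun x => ?_
  rw [conv_translate α (fun y => |u y| ^ p)]
  rfl

theorem energy_translate {b α p : ℝ} (hp : 2 < p) :
    energy b α p (translate hper z u) = energy b α p u := by
  rw [energy_eq α hp, energy_eq α hp, norm_translate, gradL_translate, nonlocal_translate]

theorem translate_mem_nehari {b α p : ℝ} (hp : 2 < p) {u : HSpace a ha h hh}
    (hu : u ∈ nehari b α p) : translate hper z u ∈ nehari b α p := by
  obtain ⟨hu0, hI⟩ := (mem_nehari_iff α hp u).1 hu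
  refine (mem_nehari_iff α hp _).2 ⟨?_, ?_⟩
  · rw [← norm_ne_zero_iff, norm_translate]
    exact norm_ne_zero_iff.2 hu0
  · unfold nehariFun at hI ⊢
    rw [norm_translate, gradL_translate, nonlocal_translate, hI]

end Translate

/-! ### Existence of a minimiser. -/

section Existence

variable {b α p : ℝ}

theorem norm_add_sq_sub (w v : HSpace a ha h hh) :
    ‖w + v‖ ^ 2 = ‖w‖ ^ 2 + ‖v‖ ^ 2 + 2 * inner ℝ w v := by
  rw [norm_add_sq_real]
  ring

theorem gradL_add_add (w v : HSpace a ha h hh) :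
    gradL (w + v) (w + v) = gradL w w + gradL v v + 2 * gradL w v := by
  simp only [map_add, _root_.add_apply, gradL_comm v w]
  ring

/-- Splitting of `reducedEnergy` and `nehariFun` along `w + v n`, where `v n` is bounded and
converges pointwise to `0`. -/
theorem exists_splitting (hp : 2 < p) (hb : 0 < b) {w : HSpace a ha h hh}
    {v : ℕ → HSpace a ha h hh} {M : ℝ} (hvM : ∀ n, ‖v n‖ ≤ M)
    (hv : ∀ x, Tendsto (fun n => v n x) atTop (𝓝 0)) :
    ∃ θ ζ : ℕ → ℝ, Tendsto θ atTop (𝓝 0) ∧ Tendsto ζ atTop (𝓝 0) ∧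
      (∀ n, reducedEnergy b p w + reducedEnergy b p (v n) + θ n ≤ reducedEnergy b p (w + v n)) ∧
      ∀ n, nehariFun b α hp (v n) ≤
        nehariFun b α hp (w + v n) - nehariFun b α hp w + ζ n := by
  obtain ⟨hin, hgr⟩ := tendsto_inner_zero (u := w) hvM hv
  set T := ‖(toEll : HSpace a ha h hh →L[ℝ] Ell 2)‖ with hT
  have hT0 : 0 ≤ T := ContinuousLinearMap.opNorm_nonneg _
  have hD := tendsto_rieszForm_powEll_add_sub α hp (u := toEll w) (v := fun n => toEll (v n))
    (M := T * M) (fun n => (toEll.le_opNorm (v n)).trans (mul_le_mul_of_nonneg_left (hvM n) hT0)) hv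
  obtain ⟨hκ, hκ'⟩ := half_sub_pos hp
  set κ := 1 / 2 - 1 / (2 * p) with hκdef
  set κ' := 1 / 4 - 1 / (2 * p) with hκdef'
  set K := gradL w w + a⁻¹ * M ^ 2 with hK
  set e1 : ℕ → ℝ := fun n => inner ℝ w (v n) with he1
  set e2 : ℕ → ℝ := fun n => gradL w (v n) with he2
  have hGK : ∀ n, gradL w w + gradL (v n) (v n) ≤ K := fun n => by
    have h1 := (v n).tsum_gradForm_le
    have h2 := mul_le_mul_of_nonneg_left (pow_le_pow_left₀ (norm_nonneg _) (hvM n) 2)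
      (inv_nonneg.2 ha.le)
    rw [hK, gradL_apply (v n)]
    linarith
  -- The difference equals `4 e2 (G(w) + G(v_n)) + 4 e2²`; the square is dropped and the bracket is
  -- at most `K`.
  have hcross : ∀ n, -(4 * |e2 n| * K) ≤
      gradL (w + v n) (w + v n) ^ 2 - (gradL w w + gradL (v n) (v n)) ^ 2 := fun n => by
    rw [gradL_add_add]
    have h1 : -(|e2 n| * K) ≤ e2 n * (gradL w w + gradL (v n) (v n)) := by
      have h3 : 0 ≤ gradL w w + gradL (v n) (v n) :=
        add_nonneg (gradL_self_nonneg w) (gradL_self_nonneg (v n))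
      have h4 : |e2 n * (gradL w w + gradL (v n) (v n))| ≤ |e2 n| * K := by
        rw [abs_mul, abs_of_nonneg h3]
        exact mul_le_mul_of_nonneg_left (hGK n) (abs_nonneg _)
      exact (abs_le.1 h4).1
    nlinarith [sq_nonneg (e2 n)]
  -- The product in `(G(w) + G(v_n))²` need not tend to `0`, which is why the splitting is
  -- one-sided; its sign favours both inequalities.
  have hprod : ∀ n, 0 ≤ gradL w w * gradL (v n) (v n) := fun n =>
    mul_nonneg (gradL_self_nonneg w) (gradL_self_nonneg (v n))
  refine ⟨fun n => κ * (2 * e1 n) - κ' * b * (4 * |e2 n| * K),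
    fun n => -(2 * e1 n) + b * (4 * |e2 n| * K) + (rieszForm α (powEll hp (toEll w + toEll (v n)))
      (powEll hp (toEll w + toEll (v n))) -
      rieszForm α (powEll hp (toEll w)) (powEll hp (toEll w)) -
      rieszForm α (powEll hp (toEll (v n))) (powEll hp (toEll (v n)))), ?_, ?_, fun n => ?_,
      fun n => ?_⟩
  · have := ((hin.const_mul 2).const_mul κ).sub
      (((hgr.abs.const_mul 4).mul_const K).const_mul (κ' * b))
    simpa using this
  · have := ((hin.const_mul 2).neg.add (((hgr.abs.const_mul 4).mul_const K).const_mul b)).add hD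
    simpa using this
  · unfold reducedEnergy
    rw [norm_add_sq_sub]
    have h1 := mul_le_mul_of_nonneg_left (hcross n) (mul_pos hκ' hb).le
    have h2 := mul_nonneg (mul_pos hκ' hb).le (hprod n)
    simp only [← hκdef, ← hκdef']
    change _ ≤ κ * (‖w‖ ^ 2 + ‖v n‖ ^ 2 + 2 * e1 n) + _
    nlinarith
  · have e3 : toEll (w + v n) = toEll w + toEll (v n) := map_add _ _ _
    unfold nehariFun nonlocal
    rw [norm_add_sq_sub, e3]
    have h1 := mul_le_mul_of_nonneg_left (hcross n) hb.le
    have h2 := mul_nonneg hb.le (hprod n)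
    change _ ≤ ‖w‖ ^ 2 + ‖v n‖ ^ 2 + 2 * e1 n + _ - _ - _ + _
    nlinarith

theorem exists_mem_box_add_smul {τ : ℤ} (hτ : τ ≠ 0) (x : V) :
    ∃ z : V, x + τ • z ∈ Finset.Icc (0 : V) (fun _ => |τ|) := by
  refine ⟨fun j => -(x j / τ), ?_⟩
  have key : ∀ j, (x + τ • fun j => -(x j / τ) : V) j = x j % τ := fun j => by
    simp only [Pi.add_apply, Pi.smul_apply, smul_eq_mul, mul_neg]
    have := Int.emod_add_mul_ediv (x j) τ
    linarith
  rw [Finset.mem_Icc]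
  constructor
  · intro j
    rw [key]
    exact Int.emod_nonneg _ hτ
  · intro j
    rw [key]
    exact (Int.emod_lt_abs _ hτ).le

/-- There is a bounded minimising sequence in the Nehari manifold which converges pointwise to a
nonzero element of `H`. -/
theorem exists_minimising_seq {τ : ℤ} (hτ : τ ≠ 0) (hper : IsPeriodic τ h) (hp : 2 < p)
    (hb : 0 < b) (hα : 0 < α) (hα' : α < 3) :
    ∃ (u : ℕ → HSpace a ha h hh) (w : HSpace a ha h hh) (M : ℝ), w ≠ 0 ∧ (∀ n, ‖u n‖ ≤ M) ∧
      (∀ n, u n ∈ nehari b α p) ∧ (∀ x, Tendsto (fun n => u n x) atTop (𝓝 (w x))) ∧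
      Tendsto (fun n => energy b α p (u n)) atTop
        (𝓝 (sInf (energy b α p '' (nehari b α p : Set (HSpace a ha h hh))))) := by
  set S : Set ℝ := energy b α p '' (nehari b α p : Set (HSpace a ha h hh)) with hS
  have hred : ∀ u : HSpace a ha h hh, u ∈ nehari b α p → energy b α p u = reducedEnergy b p u :=
    fun u hu => energy_eq_reducedEnergy α hp ((mem_nehari_iff α hp u).1 hu).2
  have hbdd : BddBelow S := ⟨0, by
    rintro _ ⟨u, hu, rfl⟩
    rw [hred u hu]
    exact reducedEnergy_nonneg hp hb u⟩
  obtain ⟨s, hanti, hslim, hsS⟩ :=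
    exists_seq_tendsto_sInf ((nonempty_nehari α hp hb hα hα').image _ : S.Nonempty) hbdd
  choose u hu hus using hsS
  obtain ⟨hκ, -⟩ := half_sub_pos hp
  set κ := 1 / 2 - 1 / (2 * p) with hκdef
  set M := Real.sqrt (κ⁻¹ * s 0) with hM
  have huM : ∀ n, ‖u n‖ ≤ M := fun n => by
    refine Real.le_sqrt_of_sq_le ?_
    rw [le_inv_mul_iff₀ hκ]
    calc κ * ‖u n‖ ^ 2 ≤ reducedEnergy b p (u n) := mul_norm_sq_le_reducedEnergy hp hb (u n)
      _ = s n := by rw [← hred _ (hu n), hus]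
      _ ≤ s 0 := hanti (Nat.zero_le n)
  obtain ⟨δ, hδ, hδu⟩ := exists_le_abs_apply_of_mem_nehari (ha := ha) (hh := hh) α hp hb M
  choose x hx using fun n => hδu (u n) (hu n) (huM n)
  choose z hz using fun n => exists_mem_box_add_smul hτ (x n)
  -- The shift brings the point `x n`, where `u n` is at least `δ` in modulus, into a finite box;
  -- pointwise convergence is uniform there, so the limit cannot be `0`.
  set t : ℕ → HSpace a ha h hh := fun n => translate hper (-z n) (u n) with ht
  have htx : ∀ n, ∃ y ∈ Finset.Icc (0 : V) (fun _ => |τ|), δ ≤ |t n y| := fun n => by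
    refine ⟨x n + τ • z n, hz n, ?_⟩
    rw [ht, translate_apply, smul_neg, add_neg_cancel_right]
    exact hx n
  have htM : ∀ n, ‖t n‖ ≤ M := fun n => by
    rw [ht, norm_translate]
    exact huM n
  obtain ⟨w, φ, hφ, hlim⟩ := exists_subseq_tendsto_pointwise htM
  refine ⟨fun n => t (φ n), w, M, ?_, fun n => htM _,
    fun n => translate_mem_nehari hper _ hp (hu _), hlim, ?_⟩
  · rintro rfl
    have hev : ∀ᶠ n in atTop, ∀ y ∈ Finset.Icc (0 : V) (fun _ => |τ|), |t (φ n) y| < δ := by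
      rw [eventually_all_finset]
      intro y _
      have h1 := (hlim y).abs
      rw [zero_apply, abs_zero] at h1
      exact (tendsto_order.1 h1).2 δ hδ
    obtain ⟨n, hn⟩ := hev.exists
    obtain ⟨y, hy, hyδ⟩ := htx (φ n)
    exact absurd (hn y hy) (not_lt.2 hyδ)
  · refine (hslim.comp hφ.tendsto_atTop).congr fun n => ?_
    rw [Function.comp_apply, ← hus, ht, energy_translate hper _ _ hp]

/-- The energy attains its infimum over the Nehari manifold. -/
theorem exists_isMinOn_nehari {τ : ℤ} (hτ : τ ≠ 0) (hper : IsPeriodic τ h) (hp : 2 < p)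
    (hb : 0 < b) (hα : 0 < α) (hα' : α < 3) :
    ∃ u ∈ (nehari b α p : Set (HSpace a ha h hh)), ∀ w ∈ (nehari b α p : Set (HSpace a ha h hh)),
      energy b α p u ≤ energy b α p w := by
  obtain ⟨u, w, M, hw0, huM, hu, hlim, hmin⟩ :=
    exists_minimising_seq (ha := ha) (hh := hh) hτ hper hp hb hα hα'
  set S : Set ℝ := energy b α p '' (nehari b α p : Set (HSpace a ha h hh)) with hS
  have hred : ∀ u : HSpace a ha h hh, u ∈ nehari b α p → energy b α p u = reducedEnergy b p u :=
    fun u hu => energy_eq_reducedEnergy α hp ((mem_nehari_iff α hp u).1 hu).2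
  have hbdd : BddBelow S := ⟨0, by
    rintro _ ⟨u, hu, rfl⟩
    rw [hred u hu]
    exact reducedEnergy_nonneg hp hb u⟩
  have hle : ∀ y : HSpace a ha h hh, y ≠ 0 → nehariFun b α hp y ≤ 0 →
      ∃ t : ℝ, t • y ∈ nehari b α p ∧ energy b α p (t • y) ≤ reducedEnergy b p y := by
    intro y hy hI
    obtain ⟨t, ht, ht1, hIt⟩ := exists_smul_nehariFun_eq_zero α hp hb hy hI
    have hmem := smul_mem_nehari α hp hy ht hIt
    exact ⟨t, hmem, (hred _ hmem).le.trans (reducedEnergy_smul_le hp hb ht.le ht1 y)⟩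
  set v : ℕ → HSpace a ha h hh := fun n => u n - w with hv
  have huv : ∀ n, w + v n = u n := fun n => add_sub_cancel w (u n)
  obtain ⟨θ, ζ, hθ, hζ, hsplit, hsplit'⟩ := exists_splitting (α := α) hp hb (w := w) (v := v)
    (M := M + ‖w‖) (fun n => (norm_sub_le _ _).trans (by linarith [huM n])) fun x => by
      have := (hlim x).sub_const (w x)
      rw [sub_self] at this
      exact this
  have hsplit₁ : ∀ n, reducedEnergy b p w + reducedEnergy b p (v n) + θ n ≤ energy b α p (u n) :=
    fun n => by
      rw [hred _ (hu n), ← huv n]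
      exact hsplit n
  -- Otherwise `I(v_n) < 0` eventually, and shrinking `v n` onto the manifold shows `reducedEnergy`
  -- of `v n` to be at least the infimum. The energy splitting would then leave `reducedEnergy` of
  -- `w` nonpositive, contradicting `w ≠ 0`.
  have hwI : nehariFun b α hp w ≤ 0 := by
    by_contra! hpos
    have hev : ∀ᶠ n in atTop, sInf S ≤ reducedEnergy b p (v n) := by
      filter_upwards [(tendsto_order.1 hζ).2 _ hpos] with n hn
      have hneg : nehariFun b α hp (v n) < 0 := by
        have h1 := hsplit' n
        rw [huv, ((mem_nehari_iff α hp _).1 (hu n)).2] at h1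
        linarith
      have hv0 : v n ≠ 0 := by
        intro h0
        rw [h0] at hneg
        have h1 : nehariFun b α hp (0 : HSpace a ha h hh) = 0 := by
          rw [← fderiv_energy_self, map_zero]
        linarith
      obtain ⟨t, htm, hte⟩ := hle (v n) hv0 hneg.le
      exact (csInf_le hbdd ⟨_, htm, rfl⟩).trans hte
    have h1 : Tendsto (fun n => energy b α p (u n) - θ n) atTop (𝓝 (sInf S)) := by
      simpa using hmin.sub hθ
    have h2 : reducedEnergy b p w + sInf S ≤ sInf S := by
      refine ge_of_tendsto h1 ?_
      filter_upwards [hev] with n hn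
      linarith [hsplit₁ n]
    have h3 := mul_norm_sq_le_reducedEnergy hp hb w
    have h4 : 0 < (1 / 2 - 1 / (2 * p)) * ‖w‖ ^ 2 := by
      have := (half_sub_pos hp).1
      have := norm_pos_iff.2 hw0
      positivity
    linarith
  -- The limit `w` itself need not be known to lie on the manifold: shrinking does not raise
  -- `reducedEnergy`, and that of `w` is at most the infimum by the splitting.
  obtain ⟨t, htm, hte⟩ := hle w hw0 hwI
  refine ⟨t • w, htm, fun y hy => ?_⟩
  refine hte.trans (le_trans ?_ (csInf_le hbdd ⟨y, hy, rfl⟩))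
  have h1 : Tendsto (fun n => energy b α p (u n) - θ n) atTop (𝓝 (sInf S)) := by
    simpa using hmin.sub hθ
  refine ge_of_tendsto' h1 fun n => ?_
  linarith [hsplit₁ n, reducedEnergy_nonneg hp hb (v n)]

end Existence

/-! ### From critical points to the pointwise equation. -/

section Equation

theorem hasSum_mul_delta (f : V → ℝ) (x : V) :
    HasSum (fun y => f y * (delta x : HSpace a ha h hh) y) (f x) := by
  have h1 := hasSum_single (f := fun y => f y * (delta x : HSpace a ha h hh) y) x fun y hy => by
    rw [delta_apply, if_neg hy, mul_zero]
  rwa [delta_apply, if_pos rfl, mul_one] at h1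

theorem sum_nbrs_zero_neg (f : V → ℝ) : ∑ e ∈ nbrs 0, f (-e) = ∑ e ∈ nbrs 0, f e := by
  refine Finset.sum_nbij' (fun e => -e) (fun e => -e) ?_ ?_ ?_ ?_ ?_ <;>
  · intro e he
    simp_all [mem_nbrs]

/-- Green's formula against `δ_x`. -/
theorem gradL_delta (u : HSpace a ha h hh) (x : V) : gradL u (delta x) = -lap u x := by
  have key : HasSum (gradForm u (delta x : HSpace a ha h hh))
      (1 / 2 * ∑ e ∈ nbrs 0, ((u x - u (x - e)) - (u (x + e) - u x))) := by
    have h1 : gradForm u (delta x : HSpace a ha h hh) = fun y => 1 / 2 * ∑ e ∈ nbrs 0,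
        ((u (y + e) - u y) * (delta x : HSpace a ha h hh) (y + e) -
          (u (y + e) - u y) * (delta x : HSpace a ha h hh) y) := by
      funext y
      unfold gradForm
      rw [sum_nbrs fun z => (u z - u y) * ((delta x : HSpace a ha h hh) z -
        (delta x : HSpace a ha h hh) y)]
      simp only [mul_sub]
    rw [h1]
    refine HasSum.mul_left _ (hasSum_sum fun e _ => ?_)
    have h2 := hasSum_mul_delta (ha := ha) (hh := hh) (fun y => u y - u (y - e)) x
    have h3 := (Equiv.addRight e).hasSum_iff.2 h2
    simp only [Function.comp_def, Equiv.coe_addRight, add_sub_cancel_right] at h3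
    exact h3.sub (hasSum_mul_delta (ha := ha) (hh := hh) (fun y => u (y + e) - u y) x)
  rw [gradL_apply, key.tsum_eq, lap, sum_nbrs fun y => u y - u x]
  simp only [Finset.sum_sub_distrib, sub_eq_add_neg x]
  -- Summation by parts produced the neighbours `x - e`; symmetry of the neighbour set turns them
  -- into `x + e`, and the two halves add up to one Laplacian.
  rw [sum_nbrs_zero_neg fun e => u (x + e)]
  ring

theorem inner_delta (u : HSpace a ha h hh) (x : V) :
    inner ℝ u (delta x) = -(a * lap u x) + h x * u x := by
  have h1 : Summable (gradForm u (delta x : HSpace a ha h hh)) :=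
    summable_gradForm u.summable_sq (delta x : HSpace a ha h hh).summable_sq
  have h2 : HasSum (fun y => h y * (u y * (delta x : HSpace a ha h hh) y)) (h x * u x) := by
    simpa only [mul_assoc] using hasSum_mul_delta (ha := ha) (hh := hh) (fun y => h y * u y) x
  rw [inner_eq_tsum, (h1.mul_left a).tsum_add h2.summable, tsum_mul_left, h2.tsum_eq,
    ← gradL_apply, gradL_delta]
  ring

theorem solvesEquation_of_hasFDerivAt {b α p : ℝ} (hp : 2 < p) {u : HSpace a ha h hh}
    (hu : HasFDerivAt (energy b α p) (0 : HSpace a ha h hh →L[ℝ] ℝ) u) :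
    SolvesEquation b α p u := by
  intro x
  have h1 := congrArg (fun L : HSpace a ha h hh →L[ℝ] ℝ => L (delta x))
    ((hasFDerivAt_energy α hp u).unique hu)
  have h2 : rieszForm α (powEll hp (toEll u))
      (mulEll (oddPowEll hp (toEll u)) (toEll (delta x : HSpace a ha h hh))) =
      conv α (fun y => |u y| ^ p) x * oddPow p (u x) := by
    rw [rieszForm_apply, ← (hasSum_mul_delta (ha := ha) (hh := hh)
      (fun y => conv α (fun y => |u y| ^ p) y * oddPow p (u y)) x).tsum_eq]
    refine tsum_congr fun y => ?_
    rw [mulEll_apply, ← mul_assoc]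
    rfl
  simp only [_root_.add_apply, _root_.sub_apply, _root_.smul_apply,
    ContinuousLinearMap.comp_apply, innerSL_apply_apply, smul_eq_mul, _root_.zero_apply,
    inner_delta, gradL_delta, h2] at h1
  rw [← gradL_apply, mul_assoc (conv α _ x)]
  unfold oddPow at h1
  linarith

end Equation

end HSpace

end KirchhoffChoquard

end

theorem theorem1p1 (a b α p : ℝ) (ha : 0 < a) (hb : 0 < b) (hα : 0 < α) (hα' : α < 3)
    (hp : 2 < p) (h : KirchhoffChoquard.V → ℝ) (hh : KirchhoffChoquard.PosBelow h)
    (τ : ℤ) (hτ : τ ≠ 0) (hper : KirchhoffChoquard.IsPeriodic τ h) :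
    ContDiff ℝ 1 (fun u : KirchhoffChoquard.HSpace a ha h hh =>
      KirchhoffChoquard.energy b α p u) ∧
    ∃ u : KirchhoffChoquard.HSpace a ha h hh,
      KirchhoffChoquard.IsGroundState b α p u ∧ KirchhoffChoquard.SolvesEquation b α p u := by
  obtain ⟨u, hu, hmin⟩ :=
    KirchhoffChoquard.exists_isMinOn_nehari (ha := ha) (hh := hh) hτ hper hp hb hα hα'
  have hcrit := KirchhoffChoquard.hasFDerivAt_energy_zero_of_isMinOn α hp hb hu hmin
  refine ⟨KirchhoffChoquard.contDiff_energy α hp, u, ⟨hcrit, hu, ?_, fun c hc => hc ⟨u, hu, rfl⟩⟩,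
    KirchhoffChoquard.solvesEquation_of_hasFDerivAt hp hcrit⟩
  rintro _ ⟨w, hw, rfl⟩
  exact hmin w hw
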